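/- **Setting.** Let $\mathcal X\subseteq\mathbb R^d$ be closed and convex, let $F:\mathbb R^d\to\mathbb R^d$ satisfy, for all $x,y\in\mathcal X$, $\|F(x)-F(y)\|\le L\|x-y\|$ and $\langle F(x)-F(y),x-y\rangle\ge\mu_F\|x-y\|^2$, and let $r:\mathbb R^d\to\mathbb R$ be lower semicontinuous and $\mu_r$-strongly convex on $\mathcal X$, where $L>0$, $\mu_F,\mu_r\ge0$ and $\mu:=\mu_F+\mu_r>0$. Let $x^*\in\mathcal X$ satisfy $\langle F(x^*),x-x^*\rangle+r(x)-r(x^*)\ge0$ for all $x\in\mathcal X$. Let $(Z_i)_{i\ge0}$ be a stationary Markov chain on a measurable space $\mathsf Z$ with Markov kernel $\mathrm Q$ and invariant distribution $\pi$, such that for some integer $\tau\ge1$ and every $k\in\mathbb N$ $$\sup_{z,z'\in\mathsf Z}\tfrac12\|\mathrm Q^k(z,\cdot)-\mathrm Q^k(z',\cdot)\|_{\mathsf{TV}}\le(1/4)^{\lfloor k/\tau\rfloor}.$$ Let $F(x,z)$ be a jointly measurable stochastic oracle with $\mathbb E_\pi[F(x,Z)]=F(x)$ and $\|F(x,z)-F(x)\|^2\le\sigma^2+\Delta^2\|x-x^*\|^2$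 for all $x\in\mathcal X$, $z\in\mathsf Z$, where $\sigma,\Delta\ge0$. **Method (randomized extragradient).** Given $\gamma>0$, $M\ge2$, $B\in\mathbb N^*$, $x^0\in\mathcal X$ and $T^0=0$, let $J_0,J_1,\dots$ be i.i.d. with $\mathbb P(J_k=j)=2^{-j}$, $j\ge1$, independent of $(Z_i)$. With $\mathrm{prox}_{\gamma r}(x)=\arg\min_{y\in\mathcal X}\{\gamma r(y)+\frac12\|x-y\|^2\}$, iteration $k$ sets $$x^{k+1/2}=\mathrm{prox}_{\gamma r}\Bigl(x^k-\tfrac{\gamma}{B}\sum_{i=1}^{B}F(x^k,Z_{T^k+i})\Bigr),\quad T^{k+1/2}=T^k+B,\quad g^k_j=\tfrac{1}{2^jB}\sum_{i=1}^{2^jB}F(x^{k+1/2},Z_{T^{k+1/2}+i}),$$ $g^k=g^k_0+2^{J_k}(g^k_{J_k}-g^k_{J_k-1})$ if $2^{J_k}\le M$ and $g^k=g^k_0$ otherwise, $x^{k+1}=\mathrm{prox}_{\gamma r}(x^k-\gamma g^k)$, $T^{k+1}=T^{k+1/2}+2^{J_k}B$. Iteration $k$ makes $B+2^{J_k}B$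 oracle calls (evaluations of $F(\cdot,Z_i)$) if $2^{J_k}\le M$, and $2B$ otherwise. **Claim.** There are universal constants $c_1,c_2,c_3,C>0$ such that the following holds for all parameters as above. Put $R=\|x^0-x^*\|$. For every $\varepsilon>0$ there is a number of iterations $N$, depending only on $\mu_F,\mu_r,L,\Delta,\sigma,R,\tau,\varepsilon$, such that for $$\gamma=\min\Bigl\{\tfrac{c_1}{\mu};\tfrac{c_1}{L};\tfrac{c_1\mu}{\Delta^2};\tfrac{c_1}{\Delta};\tfrac{c_2}{N\mu}\ln\Bigl(\max\bigl\{2;\tfrac{\mu^2NR^2}{\sigma^2}\bigr\}\Bigr)\Bigr\},\quad M=\max\Bigl\{2;\sqrt{\tfrac{c_3}{\gamma\mu}}\Bigr\},\quad B=\lceil\tau\log_2M\rceil$$ (terms with $\Delta$ are $+\infty$ if $\Delta=0$; the last term is $+\infty$ if $\sigma=0$ or $N=0$) the method satisfies $\mathbb E\|x^N-x^*\|^2\le\varepsilon$, and the expected number of oracle calls in its $N$ iterations is at most $$C\,\tau\Bigl[\kappa\,\log\Bigl(2+\tfrac{R^2}{\varepsilon}\Bigr)+\tfrac{\sigma^2}{\mu^2\varepsilon}\Bigr]\cdot\log^3\Bigl(2+\kappa+\tfrac{\sigma^2}{\mu^2\varepsilon}+\tfrac{R^2}{\varepsilon}\Bigr),\qquad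 \kappa=1+\tfrac L\mu+\tfrac\Delta\mu+\tfrac{\Delta^2}{\mu^2},$$ that is, $\tilde{\mathcal O}\bigl(\tau\bigl[(1+\frac L\mu+\frac\Delta\mu+\frac{\Delta^2}{\mu^2})\log\frac1\varepsilon+\frac{\sigma^2}{\mu^2\varepsilon}\bigr]\bigr)$. -/

import Mathlib

open MeasureTheory ProbabilityTheory

/-- The space `ℝ^d` with its Euclidean norm. -/
abbrev RSpace (d : ℕ) : Type := EuclideanSpace ℝ (Fin d)

/-! ### The variational inequality -/

/-- `xs` solves the variational inequality: `xs ∈ X` and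
`⟪F xs, x - xs⟫ + r x - r xs ≥ 0` for all `x ∈ X`. -/
def IsVISolution {d : ℕ} (X : Set (RSpace d)) (F : RSpace d → RSpace d) (r : RSpace d → ℝ)
    (xs : RSpace d) : Prop :=
  xs ∈ X ∧ ∀ x ∈ X, 0 ≤ inner ℝ (F xs) (x - xs) + r x - r xs

/-- The data of the (strongly) monotone composite variational inequality: a closed convex set `X`,
an operator `F` that is `L`-Lipschitz and `μF`-strongly monotone on `X`, and a regularizer `r` that
is lower semicontinuous and `μr`-strongly convex on `X` (plain monotonicity, resp. convexity, if the
modulus is `0`). -/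
structure IsMonotoneVI {d : ℕ} (X : Set (RSpace d)) (F : RSpace d → RSpace d)
    (r : RSpace d → ℝ) (L μF μr : ℝ) : Prop where
  isClosed : IsClosed X
  convex : Convex ℝ X
  lsc : LowerSemicontinuousOn r X
  lipschitz : ∀ x ∈ X, ∀ y ∈ X, ‖F x - F y‖ ≤ L * ‖x - y‖
  strongMono : ∀ x ∈ X, ∀ y ∈ X, μF * ‖x - y‖ ^ 2 ≤ inner ℝ (F x - F y) (x - y)
  strongConvex : StrongConvexOn X μr r

/-! ### Markovian noise -/

/-- The total variation norm `‖μ - ν‖_TV` of the signed measure `μ - ν`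
(so it equals `2` for mutually singular probability measures). -/
noncomputable def tvNormSub {S : Type*} [MeasurableSpace S] (μ ν : Measure S)
    [IsFiniteMeasure μ] [IsFiniteMeasure ν] : ℝ :=
  (μ.toSignedMeasure - ν.toSignedMeasure).totalVariation.real Set.univ

instance isMarkovKernel_kernelPow {S : Type*} [MeasurableSpace S] (Q : Kernel S S)
    [IsMarkovKernel Q] (k : ℕ) : IsMarkovKernel (Q ^ k) := by
  induction k with
  | zero => exact inferInstanceAs (IsMarkovKernel (Kernel.id : Kernel S S))
  | succ k ih => rw [pow_succ]; exact inferInstanceAs (IsMarkovKernel ((Q ^ k) ∘ₖ Q))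

/-- `Q` is uniformly geometrically ergodic with mixing time `τ ≥ 1`: for every `k`,
`sup_{z, z'} (1/2) ‖Q^k(z, ·) - Q^k(z', ·)‖_TV ≤ (1/4)^⌊k/τ⌋` (natural number division). -/
def IsUniformlyErgodic {S : Type*} [MeasurableSpace S] (Q : Kernel S S) [IsMarkovKernel Q]
    (τ : ℕ) : Prop :=
  1 ≤ τ ∧ ∀ (k : ℕ) (z z' : S),
    (1 / 2 : ℝ) * tvNormSub ((Q ^ k) z) ((Q ^ k) z') ≤ (1 / 4 : ℝ) ^ (k / τ)

/-- `Z` is a time-homogeneous Markov chain with kernel `Q` and initial law `ν`: the joint law of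
`((Z 0, …, Z n), Z (n + 1))` is the law of `(Z 0, …, Z n)` followed by a `Q`-step from `Z n`. -/
structure IsMarkovChain {Ω S : Type*} [MeasurableSpace Ω] [MeasurableSpace S] (P : Measure Ω)
    (ν : Measure S) (Q : Kernel S S) (Z : ℕ → Ω → S) : Prop where
  measurable : ∀ n, Measurable (Z n)
  initial : P.map (Z 0) = ν
  step : ∀ n : ℕ,
    P.map (fun ω => ((fun i : Fin (n + 1) => Z i ω), Z (n + 1) ω)) =
      (P.map (fun ω => fun i : Fin (n + 1) => Z i ω)) ⊗ₘ
        (Q.comap (fun h : Fin (n + 1) → S => h (Fin.last n)) (measurable_pi_apply _))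

/-- The stochastic oracle `Fz x z` for `F`: jointly measurable, unbiased under `π`, with noise
uniformly bounded by `σ² + Δ² ‖x - xs‖²` on `X`. -/
structure IsNoisyOracle {d : ℕ} {S : Type*} [MeasurableSpace S] (X : Set (RSpace d))
    (F : RSpace d → RSpace d) (Fz : RSpace d → S → RSpace d) (π : Measure S) (xs : RSpace d)
    (σ Δ : ℝ) : Prop where
  measurable : Measurable (fun p : RSpace d × S => Fz p.1 p.2)
  unbiased : ∀ x ∈ X, ∫ z, Fz x z ∂π = F x
  growth : ∀ x ∈ X, ∀ z, ‖Fz x z - F x‖ ^ 2 ≤ σ ^ 2 + Δ ^ 2 * ‖x - xs‖ ^ 2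

/-- `J 0, J 1, …` are independent, each geometric with parameter `1/2` on `{1, 2, …}`. -/
structure IsGeometricSequence {Ω : Type*} [MeasurableSpace Ω] (P : Measure Ω)
    (J : ℕ → Ω → ℕ) : Prop where
  measurable : ∀ k, Measurable (J k)
  indep : iIndepFun J P
  law : ∀ k j : ℕ, P {ω | J k ω = j + 1} = (2⁻¹ : ENNReal) ^ (j + 1)

/-! ### The randomized extragradient method -/

/-- `prox_{γ r}(x) = argmin_{y ∈ X} (γ r(y) + ‖x - y‖² / 2)`. -/
noncomputable def proxOn {d : ℕ} (X : Set (RSpace d)) (r : RSpace d → ℝ) (γ : ℝ)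
    (x : RSpace d) : RSpace d :=
  Classical.epsilon fun p => p ∈ X ∧ IsMinOn (fun y => γ * r y + ‖x - y‖ ^ 2 / 2) X p

/-- `n⁻¹ ∑_{i = 1}^{n} F(x, z_{T + i})`. -/
noncomputable def batchMean {d : ℕ} {S : Type*} (Fz : RSpace d → S → RSpace d) (z : ℕ → S)
    (x : RSpace d) (T n : ℕ) : RSpace d :=
  (n : ℝ)⁻¹ • ∑ i ∈ Finset.Icc 1 n, Fz x (z (T + i))

/-- The randomized-batch estimate `g = g₀ + 2^j (g_j - g_{j-1})` if `2^j ≤ M`, and `g = g₀`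
otherwise, where `g_i` averages the `2^i B` samples that follow time `T`. -/
noncomputable def randomBatchEstimate {d : ℕ} {S : Type*} (Fz : RSpace d → S → RSpace d)
    (z : ℕ → S) (M : ℝ) (B : ℕ) (x : RSpace d) (T j : ℕ) : RSpace d :=
  batchMean Fz z x T B +
    if (2 : ℝ) ^ j ≤ M then
      (2 : ℝ) ^ j • (batchMean Fz z x T (2 ^ j * B) - batchMean Fz z x T (2 ^ (j - 1) * B))
    else 0

/-- One iteration of the method, mapping the pair `(x^k, T^k)` to `(x^{k+1}, T^{k+1})`. -/
noncomputable def extragradStep {d : ℕ} {S : Type*} (X : Set (RSpace d)) (r : RSpace d → ℝ)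
    (Fz : RSpace d → S → RSpace d) (γ M : ℝ) (B : ℕ) (z : ℕ → S) (j : ℕ)
    (s : RSpace d × ℕ) : RSpace d × ℕ :=
  let xHalf := proxOn X r γ (s.1 - γ • batchMean Fz z s.1 s.2 B)
  let THalf := s.2 + B
  (proxOn X r γ (s.1 - γ • randomBatchEstimate Fz z M B xHalf THalf j), THalf + 2 ^ j * B)

/-- The pair `(x^k, T^k)` after `k` iterations from `(x⁰, 0)`, along the sample path `z` of the
chain and the levels `j 0, j 1, …`. -/
noncomputable def extragradState {d : ℕ} {S : Type*} (X : Set (RSpace d)) (r : RSpace d → ℝ)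
    (Fz : RSpace d → S → RSpace d) (γ M : ℝ) (B : ℕ) (x₀ : RSpace d) (z : ℕ → S) (j : ℕ → ℕ) :
    ℕ → RSpace d × ℕ
  | 0 => (x₀, 0)
  | k + 1 => extragradStep X r Fz γ M B z (j k) (extragradState X r Fz γ M B x₀ z j k)

/-- The number of oracle calls in the first `N` iterations: each iteration queries the `B` samples
of the extrapolation step, and then `2^{j_k} B` samples if `2^{j_k} ≤ M` and `B` samples (those of
`g₀`) otherwise. -/
noncomputable def oracleCalls (M : ℝ) (B : ℕ) (j : ℕ → ℕ) (N : ℕ) : ℝ :=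
  ∑ k ∈ Finset.range N, ((B : ℝ) + if (2 : ℝ) ^ j k ≤ M then (2 : ℝ) ^ j k * B else B)

/-! ### Parameters -/

/-- The stepsize
`min {c₁/μ; c₁/L; c₁ μ/Δ²; c₁/Δ; c₂/(N μ) · ln (max {2; μ² N R²/σ²})}`.
The minimum of the first four terms is written as `c₁ / max {μ; L; Δ²/μ; Δ}`, so that for `Δ = 0`
the terms with `Δ` impose nothing; likewise the last term is `+∞` if `σ = 0` or `N = 0`. -/
noncomputable def stepsize (c₁ c₂ μ L Δ σ R : ℝ) (N : ℕ) : ℝ :=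
  if σ = 0 ∨ N = 0 then c₁ / max (max μ L) (max (Δ ^ 2 / μ) Δ)
  else min (c₁ / max (max μ L) (max (Δ ^ 2 / μ) Δ))
    (c₂ / (N * μ) * Real.log (max 2 (μ ^ 2 * N * R ^ 2 / σ ^ 2)))

/-- The batch limit `M = max {2; √(c₃ / (γ μ))}`. -/
noncomputable def batchLimit (c₃ γ μ : ℝ) : ℝ := max 2 (Real.sqrt (c₃ / (γ * μ)))

/-- The base batch size `B = ⌈b log₂ M⌉`. -/
noncomputable def baseBatch (b : ℕ) (M : ℝ) : ℕ := ⌈(b : ℝ) * Real.logb 2 M⌉₊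

/-- The condition number `1 + L/μ + Δ/μ + Δ²/μ²`. -/
noncomputable def condNumber (μ L Δ : ℝ) : ℝ := 1 + L / μ + Δ / μ + Δ ^ 2 / μ ^ 2

/-- The noise level `σ²/(μ² ε)`. -/
noncomputable def noiseLevel (μ σ ε : ℝ) : ℝ := σ ^ 2 / (μ ^ 2 * ε)

/-! ### The proximal map -/

/-! One extragradient step satisfies a deterministic inequality valid for arbitrary estimates `h`
and `g` (`extragrad_descent`). It gains `‖x - y‖²` and `γ μ ‖y - xs‖²`, and loses `γ² ‖h - g‖²` and
the correlation of the error `g - F y` with `y - xs`. The point is to make `g` almost unbiased at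
logarithmic expected cost.

The random level does this. Level `j` has probability `2^(-j)` and its correction carries the weight
`2^j`, so averaging turns weighted terms into a plain sum over `1 ≤ j ≤ l`, where `2^l ≤ M <
2^(l+1)` (`IsGeometricSequence.integral_ite`). The mean corrections telescope, leaving the bias of
one batch of `2^l B` samples. By mixing this is `O(τ / (2^l B)) = O(1/M)`, and since `M² ≥ 1 / (γ
μ)` Young's inequality absorbs it (`bias_young`). The mean square error of a batch of `2^j B`
samples is `O(τ / (2^j B))`, so after weighting every level costs `O(τ / B)`, and `l τ ≤ B` keeps
the total bounded. The squared error thus contracts by `1 - γ μ / 16` up to an additive `284 γ² σ²`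
(`IsAdaptedIn.exists_extragradStep_average_le`).

These moments are computed with the levels frozen: the sampling times are then deterministic and
each iterate is a bounded function of past samples, so the Markov property applies. The levels,
independent of the chain and of each other, are averaged afterwards, one at a time
(`integral_le_of_level_recursion`).

Iterating gives `exp(-γ μ N / 16) R² + O(γ σ² / μ)`, and the choice of `γ` and `N` makes both terms
at most `ε / 2` (`accuracy_le`). An iteration costs at most `(l + 2) B = O(τ log² M)` calls in
expectation; the third logarithm of the bound comes from `N` (`iterationCount_mul_le`). -/

lemma le_of_forall_le_add_mul {a b c : ℝ} (h : ∀ t : ℝ, 0 < t → t ≤ 1 → a ≤ b + t * c) :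
    a ≤ b := by
  by_contra! hab
  have hc : 0 < |c| + 1 := by positivity
  -- At this `t` the term `t * c` is less than half of the gap `a - b`.
  set t := min 1 ((a - b) / (2 * (|c| + 1)))
  have ht : 0 < t := lt_min one_pos (div_pos (by linarith) (by positivity))
  have h1 := h t ht (min_le_left _ _)
  have h2 : t * (2 * (|c| + 1)) ≤ a - b := by
    rw [← le_div_iff₀ (by positivity)]; exact min_le_right _ _
  nlinarith [le_abs_self c]

section Prox

variable {d : ℕ} {X : Set (RSpace d)} {F : RSpace d → RSpace d} {r : RSpace d → ℝ}
  {L μF μr γ : ℝ} {xs : RSpace d}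

lemma strongConvexOn_segment (hr : StrongConvexOn X μr r) {p u : RSpace d} (hp : p ∈ X)
    (hu : u ∈ X) {t : ℝ} (ht : 0 < t) (ht1 : t ≤ 1) :
    p + t • (u - p) ∈ X ∧
      r (p + t • (u - p)) ≤ r p + t * (r u - r p) - (1 - t) * t * (μr / 2 * ‖u - p‖ ^ 2) := by
  have e : p + t • (u - p) = (1 - t) • p + t • u := by module
  have h1 : (0 : ℝ) ≤ 1 - t := by linarith
  refine ⟨e ▸ hr.1 hp hu h1 ht.le (by ring), ?_⟩
  have h := hr.2 hp hu h1 ht.le (by ring)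
  rw [e]
  simp only [smul_eq_mul] at h
  rw [norm_sub_rev p u] at h
  linarith

/-- Testing the inequality at `xs + t • (u - xs)`, dividing by `t` and letting `t → 0` upgrades it
by the quadratic term from the strong convexity of `r`. -/
lemma IsVISolution.strong (hVI : IsMonotoneVI X F r L μF μr) (hs : IsVISolution X F r xs)
    {u : RSpace d} (hu : u ∈ X) :
    μr / 2 * ‖u - xs‖ ^ 2 ≤ inner ℝ (F xs) (u - xs) + r u - r xs := by
  refine le_of_forall_le_add_mul (c := μr / 2 * ‖u - xs‖ ^ 2) fun t ht ht1 => ?_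
  obtain ⟨hmem, hle⟩ := strongConvexOn_segment hVI.strongConvex hs.1 hu ht ht1
  have h := hs.2 _ hmem
  rw [add_sub_cancel_left, inner_smul_right] at h
  have : 0 ≤ t * (inner ℝ (F xs) (u - xs) + r u - r xs + t * (μr / 2 * ‖u - xs‖ ^ 2)
      - μr / 2 * ‖u - xs‖ ^ 2) := by linarith
  linarith [nonneg_of_mul_nonneg_right this ht]

/-- The variational inequality bounds `r` below by an affine function on `X`, so the objective is
coercive. The radius `K` is chosen so that outside the ball the value is at least that at `xs`; a
minimizer over the compact part is then global. -/
lemma exists_prox (hVI : IsMonotoneVI X F r L μF μr) (hs : IsVISolution X F r xs) (hγ : 0 < γ)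
    (x : RSpace d) :
    ∃ p, p ∈ X ∧ IsMinOn (fun y => γ * r y + ‖x - y‖ ^ 2 / 2) X p := by
  set φ : RSpace d → ℝ := fun y => γ * r y + ‖x - y‖ ^ 2 / 2 with hφ
  set K : ℝ := 4 * γ * ‖F xs‖ + 2 * ‖x - xs‖ with hK
  have hlsc : LowerSemicontinuousOn φ X := by
    have hc : Continuous fun y : RSpace d => ‖x - y‖ ^ 2 / 2 := by fun_prop
    refine LowerSemicontinuousOn.add ?_ (hc.lowerSemicontinuous.lowerSemicontinuousOn X)
    exact Continuous.comp_lowerSemicontinuousOn (g := fun a : ℝ => γ * a) (by fun_prop) hVI.lsc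
      (fun a b hab => mul_le_mul_of_nonneg_left hab hγ.le)
  have hcomp : IsCompact (X ∩ Metric.closedBall xs K) :=
    (isCompact_closedBall xs K).inter_left hVI.isClosed
  have hK0 : 0 ≤ K := by positivity
  have hmem : xs ∈ X ∩ Metric.closedBall xs K := ⟨hs.1, by simpa using hK0⟩
  obtain ⟨p, hp, hmin⟩ := LowerSemicontinuousOn.exists_isMinOn ⟨xs, hmem⟩ hcomp
    (hlsc.mono Set.inter_subset_left)
  refine ⟨p, hp.1, fun y hy => ?_⟩
  by_cases hyK : ‖y - xs‖ ≤ K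
  · exact hmin ⟨hy, by simpa [dist_eq_norm] using hyK⟩
  · push Not at hyK
    refine le_trans (show φ p ≤ φ xs from hmin hmem) ?_
    have h1 := hs.2 y hy
    have h2 := real_inner_le_norm (F xs) (y - xs)
    have h3 : ‖y - xs‖ ≤ ‖x - y‖ + ‖x - xs‖ := by
      have := norm_sub_le (x - xs) (x - y)
      rw [sub_sub_sub_cancel_left] at this
      linarith
    have h4 : ‖y - xs‖ ^ 2 ≤ 2 * ‖x - y‖ ^ 2 + 2 * ‖x - xs‖ ^ 2 := by
      nlinarith [sq_nonneg (‖x - y‖ - ‖x - xs‖), norm_nonneg (y - xs)]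
    have h5 : γ * (r xs - r y) ≤ γ * (‖F xs‖ * ‖y - xs‖) :=
      mul_le_mul_of_nonneg_left (by linarith) hγ.le
    have h6 : 0 ≤ γ * ‖F xs‖ := by positivity
    have h7 : ‖y - xs‖ * K ≤ ‖y - xs‖ * ‖y - xs‖ :=
      mul_le_mul_of_nonneg_left hyK.le (norm_nonneg _)
    have h8 : 2 * ‖x - xs‖ ≤ ‖y - xs‖ := by linarith
    have h9 : 2 * ‖x - xs‖ * ‖x - xs‖ ≤ ‖y - xs‖ * ‖x - xs‖ :=
      mul_le_mul_of_nonneg_right h8 (norm_nonneg _)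
    show γ * r xs + ‖x - xs‖ ^ 2 / 2 ≤ γ * r y + ‖x - y‖ ^ 2 / 2
    rw [hK] at h7
    nlinarith

lemma proxOn_spec (hVI : IsMonotoneVI X F r L μF μr) (hs : IsVISolution X F r xs) (hγ : 0 < γ)
    (x : RSpace d) : proxOn X r γ x ∈ X ∧
      IsMinOn (fun y => γ * r y + ‖x - y‖ ^ 2 / 2) X (proxOn X r γ x) :=
  Classical.epsilon_spec (exists_prox hVI hs hγ x)

lemma proxOn_mem (hVI : IsMonotoneVI X F r L μF μr) (hs : IsVISolution X F r xs) (hγ : 0 < γ)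
    (x : RSpace d) : proxOn X r γ x ∈ X := (proxOn_spec hVI hs hγ x).1

/-- First-order optimality: compare the minimizer `p` with `p + t • (u - p)`, divide by `t` and let
`t → 0`. The constant `c` collects all second-order terms in `t`. -/
lemma inner_proxOn_le (hVI : IsMonotoneVI X F r L μF μr) (hs : IsVISolution X F r xs)
    (hγ : 0 < γ) (x : RSpace d) {u : RSpace d} (hu : u ∈ X) :
    inner ℝ (x - proxOn X r γ x) (u - proxOn X r γ x) ≤
      γ * (r u - r (proxOn X r γ x)) - γ * μr / 2 * ‖u - proxOn X r γ x‖ ^ 2 := by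
  obtain ⟨hp, hmin⟩ := proxOn_spec hVI hs hγ x
  set p := proxOn X r γ x
  refine le_of_forall_le_add_mul (c := γ * μr / 2 * ‖u - p‖ ^ 2 + ‖u - p‖ ^ 2 / 2)
    fun t ht ht1 => ?_
  obtain ⟨hmem, hle⟩ := strongConvexOn_segment hVI.strongConvex hp hu ht ht1
  have h : γ * r p + ‖x - p‖ ^ 2 / 2 ≤
      γ * r (p + t • (u - p)) + ‖x - (p + t • (u - p))‖ ^ 2 / 2 := hmin hmem
  have e : ‖x - (p + t • (u - p))‖ ^ 2 =
      ‖x - p‖ ^ 2 - 2 * (t * inner ℝ (x - p) (u - p)) + t ^ 2 * ‖u - p‖ ^ 2 := by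
    rw [← sub_sub, norm_sub_sq_real, inner_smul_right, norm_smul, mul_pow, Real.norm_eq_abs,
      sq_abs]
  have h' := mul_le_mul_of_nonneg_left hle hγ.le
  rw [e] at h
  have : 0 ≤ t * (γ * (r u - r p) - γ * μr / 2 * ‖u - p‖ ^ 2
      + t * (γ * μr / 2 * ‖u - p‖ ^ 2 + ‖u - p‖ ^ 2 / 2) - inner ℝ (x - p) (u - p)) := by
    linarith
  linarith [nonneg_of_mul_nonneg_right this ht]

/-- Adding the optimality conditions of two prox points shows that the map is nonexpansive.
Continuity supplies measurability of the iterates and boundedness on balls. -/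
lemma continuous_proxOn (hVI : IsMonotoneVI X F r L μF μr) (hs : IsVISolution X F r xs)
    (hγ : 0 < γ) (hμr : 0 ≤ μr) : Continuous (proxOn X r γ) := by
  refine (LipschitzWith.of_dist_le_mul (K := 1) fun x y => ?_).continuous
  have h1 := inner_proxOn_le hVI hs hγ x (proxOn_mem hVI hs hγ y)
  have h2 := inner_proxOn_le hVI hs hγ y (proxOn_mem hVI hs hγ x)
  set p := proxOn X r γ x
  set q := proxOn X r γ y
  have h3 : 0 ≤ γ * μr / 2 * ‖q - p‖ ^ 2 := by positivity
  have h4 : 0 ≤ γ * μr / 2 * ‖p - q‖ ^ 2 := by positivity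
  have e : ‖p - q‖ ^ 2 - inner ℝ (x - y) (p - q) =
      inner ℝ (x - p) (q - p) + inner ℝ (y - q) (p - q) := by
    rw [← real_inner_self_eq_norm_sq]
    simp only [inner_sub_left, inner_sub_right]
    ring
  have h5 := real_inner_le_norm (x - y) (p - q)
  have h6 : ‖p - q‖ * ‖p - q‖ ≤ ‖x - y‖ * ‖p - q‖ := by nlinarith
  rw [dist_eq_norm, dist_eq_norm, NNReal.coe_one, one_mul]
  by_contra! hlt
  have := norm_nonneg (x - y)
  nlinarith

/-- The extragradient step with arbitrary estimates `h` and `g` of the operator at the current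
point and at the extrapolated point. -/
lemma extragrad_descent (hVI : IsMonotoneVI X F r L μF μr) (hs : IsVISolution X F r xs)
    (hγ : 0 < γ) (hμF : 0 ≤ μF) (hμr : 0 ≤ μr) (x h g : RSpace d) {y x' : RSpace d}
    (hy : y = proxOn X r γ (x - γ • h)) (hx' : x' = proxOn X r γ (x - γ • g)) :
    ‖x' - xs‖ ^ 2 ≤ ‖x - xs‖ ^ 2 - ‖x - y‖ ^ 2 + γ ^ 2 * ‖h - g‖ ^ 2
      - 2 * γ * inner ℝ (g - F y) (y - xs) - γ * (μF + μr) * ‖y - xs‖ ^ 2 := by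
  have hyX : y ∈ X := hy ▸ proxOn_mem hVI hs hγ _
  have hx'X : x' ∈ X := hx' ▸ proxOn_mem hVI hs hγ _
  -- The first prox is tested at `x'` and the second at `xs`; in the sum the values `r x'` cancel.
  have h1 := inner_proxOn_le hVI hs hγ (x - γ • h) hx'X
  have h2 := inner_proxOn_le hVI hs hγ (x - γ • g) hs.1
  rw [← hy] at h1
  rw [← hx'] at h2
  have h3 := mul_le_mul_of_nonneg_left (hs.strong hVI hyX) hγ.le
  have h4 := mul_le_mul_of_nonneg_left (hVI.strongMono y hyX xs hs.1) hγ.le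
  -- Young's inequality for `2γ⟪h - g, x' - y⟫`; its `‖x' - y‖²` is paid by the first prox
  -- inequality.
  have h5 : 0 ≤ ‖γ • (h - g) - (x' - y)‖ ^ 2 := by positivity
  rw [norm_sub_sq_real, norm_smul, mul_pow, Real.norm_eq_abs, sq_abs, real_inner_smul_left] at h5
  have h6 : 0 ≤ γ * μr * ‖x' - y‖ ^ 2 := by positivity
  have h7 : 0 ≤ γ * μr * ‖xs - x'‖ ^ 2 := by positivity
  -- Strong monotonicity yields `2γ μF`, strong convexity only `γ μr`; half of the former is dropped
  -- so that both combine into `μF + μr`.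
  have h8 : 0 ≤ γ * μF * ‖y - xs‖ ^ 2 := by positivity
  have e1 : 2 * inner ℝ (x - γ • h - y) (x' - y) =
      ‖x - y‖ ^ 2 + ‖x' - y‖ ^ 2 - ‖x - x'‖ ^ 2 - 2 * γ * inner ℝ h (x' - y) := by
    rw [show x - x' = (x - y) - (x' - y) by abel, norm_sub_sq_real (x - y),
      show x - γ • h - y = (x - y) - γ • h by abel, inner_sub_left, real_inner_smul_left]
    ring
  have e2 : 2 * inner ℝ (x - γ • g - x') (xs - x') =
      ‖x - x'‖ ^ 2 + ‖x' - xs‖ ^ 2 - ‖x - xs‖ ^ 2 - 2 * γ * inner ℝ g (xs - x') := by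
    rw [show x - xs = (x - x') - (xs - x') by abel, norm_sub_sq_real (x - x'), norm_sub_rev x' xs,
      show x - γ • g - x' = (x - x') - γ • g by abel, inner_sub_left, real_inner_smul_left]
    ring
  have e3 : inner ℝ h (x' - y) + inner ℝ g (xs - x') =
      inner ℝ (h - g) (x' - y) - inner ℝ g (y - xs) := by
    simp only [inner_sub_left, inner_sub_right]; ring
  have e4 : inner ℝ g (y - xs) =
      inner ℝ (g - F y) (y - xs) + inner ℝ (F y - F xs) (y - xs) + inner ℝ (F xs) (y - xs) := by
    simp only [inner_sub_left]; ring
  have e5 : γ * inner ℝ h (x' - y) + γ * inner ℝ g (xs - x') =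
      γ * inner ℝ (h - g) (x' - y) - γ * inner ℝ g (y - xs) := by
    rw [← mul_add, e3]; ring
  have e6 : γ * inner ℝ g (y - xs) = γ * inner ℝ (g - F y) (y - xs)
      + γ * inner ℝ (F y - F xs) (y - xs) + γ * inner ℝ (F xs) (y - xs) := by
    rw [e4]; ring
  linarith

end Prox

/-! ### Total variation and Markov chains -/

section Markov

variable {S : Type*} [MeasurableSpace S]

lemma integrable_of_abs_le {α : Type*} [MeasurableSpace α] {μ : Measure α} [IsFiniteMeasure μ]
    {h : α → ℝ} (hm : Measurable h) {c : ℝ} (hc : ∀ z, |h z| ≤ c) : Integrable h μ :=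
  Integrable.of_bound hm.aestronglyMeasurable c (.of_forall fun z => by simpa using hc z)

/-- The Jordan decomposition of `μ - ν` gives the identity of measures `μ + j.negPart = ν +
j.posPart`, so the difference of integrals is carried by the two parts, whose masses add up to the
total variation. -/
lemma abs_integral_sub_le_tvNormSub (μ ν : Measure S) [IsFiniteMeasure μ] [IsFiniteMeasure ν]
    {h : S → ℝ} (hm : Measurable h) {c : ℝ} (hc : ∀ z, |h z| ≤ c) :
    |∫ z, h z ∂μ - ∫ z, h z ∂ν| ≤ c * tvNormSub μ ν := by
  set s := μ.toSignedMeasure - ν.toSignedMeasure with hs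
  set j := s.toJordanDecomposition with hj
  have hadd : μ + j.negPart = ν + j.posPart := by
    have h1 : j.posPart.toSignedMeasure - j.negPart.toSignedMeasure = s :=
      s.toSignedMeasure_toJordanDecomposition
    rw [← Measure.toSignedMeasure_eq_toSignedMeasure_iff, Measure.toSignedMeasure_add,
      Measure.toSignedMeasure_add, add_comm ν.toSignedMeasure]
    exact (sub_eq_sub_iff_add_eq_add.1 (h1.trans hs)).symm
  have h2 : ∫ z, h z ∂μ + ∫ z, h z ∂j.negPart = ∫ z, h z ∂ν + ∫ z, h z ∂j.posPart := by
    rw [← integral_add_measure (integrable_of_abs_le hm hc) (integrable_of_abs_le hm hc),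
      ← integral_add_measure (integrable_of_abs_le hm hc) (integrable_of_abs_le hm hc), hadd]
  have hb : ∀ (ρ : Measure S) [IsFiniteMeasure ρ], |∫ z, h z ∂ρ| ≤ c * ρ.real Set.univ :=
    fun ρ _ => by simpa using norm_integral_le_of_norm_le_const (μ := ρ) (f := h) (.of_forall hc)
  have h3 : tvNormSub μ ν = j.posPart.real Set.univ + j.negPart.real Set.univ := by
    rw [tvNormSub, SignedMeasure.totalVariation, measureReal_add_apply]
  have h4 : ∫ z, h z ∂μ - ∫ z, h z ∂ν = ∫ z, h z ∂j.posPart - ∫ z, h z ∂j.negPart := by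
    linarith
  rw [h3, h4, mul_add]
  exact (abs_sub _ _).trans (add_le_add (hb _) (hb _))

lemma kernelPow_invariant {Q : Kernel S S} {π : Measure S} (h : Q.Invariant π) (k : ℕ) :
    (Q ^ k).Invariant π := by
  induction k with
  | zero => exact Measure.bind_dirac
  | succ k ih => rw [pow_succ]; exact ih.comp h

/-- Started anywhere, the chain forgets its initial state. -/
lemma IsUniformlyErgodic.abs_integral_sub_le {Q : Kernel S S} [IsMarkovKernel Q] {τ : ℕ}
    (hQ : IsUniformlyErgodic Q τ) {π : Measure S} [IsProbabilityMeasure π] (hπ : Q.Invariant π)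
    {h : S → ℝ} (hm : Measurable h) {c : ℝ} (hc : ∀ z, |h z| ≤ c) (k : ℕ) (z : S) :
    |∫ s, h s ∂((Q ^ k) z) - ∫ s, h s ∂π| ≤ 2 * c * (1 / 4) ^ (k / τ) := by
  have hc0 : 0 ≤ c := (abs_nonneg _).trans (hc z)
  -- Invariance writes `π` as the `π`-average of the laws `(Q ^ k) z'`, and ergodicity compares `(Q
  -- ^ k) z` with each of these.
  have hQπ : π = ((Q ^ k) ∘ₖ Kernel.const Unit π) () := by
    rw [← Measure.comp_eq_comp_const_apply]; exact (kernelPow_invariant hπ k).symm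
  have h1 : ∫ s, h s ∂π = ∫ z', ∫ s, h s ∂((Q ^ k) z') ∂π := by
    conv_lhs => rw [hQπ]
    rw [Kernel.integral_comp (integrable_of_abs_le hm hc), Kernel.const_apply]
  have hm' : Measurable fun z' => ∫ s, h s ∂((Q ^ k) z') :=
    (StronglyMeasurable.integral_kernel (κ := Q ^ k) hm.stronglyMeasurable).measurable
  have hc' : ∀ z', |∫ s, h s ∂((Q ^ k) z')| ≤ c := fun z' => by
    simpa using norm_integral_le_of_norm_le_const (μ := (Q ^ k) z') (f := h) (.of_forall hc)
  have h2 : ∫ s, h s ∂((Q ^ k) z) - ∫ s, h s ∂π =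
      ∫ z', (∫ s, h s ∂((Q ^ k) z) - ∫ s, h s ∂((Q ^ k) z')) ∂π := by
    rw [integral_sub (integrable_const _) (integrable_of_abs_le hm' hc'), h1]
    simp
  have h3 : ∀ z', |∫ s, h s ∂((Q ^ k) z) - ∫ s, h s ∂((Q ^ k) z')| ≤
      2 * c * (1 / 4) ^ (k / τ) := fun z' => by
    refine (abs_integral_sub_le_tvNormSub _ _ hm hc).trans ?_
    nlinarith [mul_le_mul_of_nonneg_left (hQ.2 k z z') hc0]
  rw [h2]
  simpa using norm_integral_le_of_norm_le_const (μ := π)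
    (f := fun z' => ∫ s, h s ∂((Q ^ k) z) - ∫ s, h s ∂((Q ^ k) z')) (.of_forall h3)

variable {Ω : Type*} [MeasurableSpace Ω] {P : Measure Ω} [IsProbabilityMeasure P]
  {π : Measure S} {Q : Kernel S S} [IsMarkovKernel Q] {Z : ℕ → Ω → S}

/-- The `i`-step Markov property given the whole past: condition on the history up to `n + i`, apply
one step, and use Chapman–Kolmogorov. -/
lemma IsMarkovChain.lintegral_eq (hZ : IsMarkovChain P π Q Z) (n i : ℕ)
    {f : (Fin (n + 1) → S) × S → ENNReal} (hf : Measurable f) :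
    ∫⁻ ω, f (fun a : Fin (n + 1) => Z a ω, Z (n + i) ω) ∂P =
      ∫⁻ ω, ∫⁻ s, f (fun a : Fin (n + 1) => Z a ω, s) ∂((Q ^ i) (Z n ω)) ∂P := by
  have hZm := hZ.measurable
  induction i generalizing f with
  | zero =>
    refine lintegral_congr fun ω => ?_
    have : (Q ^ 0) (Z n ω) = Measure.dirac (Z n ω) := rfl
    rw [this, lintegral_dirac' _ (by fun_prop)]
    rfl
  | succ i ih =>
    have hg : Measurable fun p : (Fin (n + 1) → S) × S => ∫⁻ s, f (p.1, s) ∂(Q p.2) := by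
      have : Measurable fun q : ((Fin (n + 1) → S) × S) × S => f (q.1.1, q.2) := by fun_prop
      exact this.lintegral_kernel_prod_right' (κ := Q.comap Prod.snd measurable_snd)
    have h1 : ∫⁻ ω, f (fun a : Fin (n + 1) => Z a ω, Z (n + (i + 1)) ω) ∂P =
        ∫⁻ ω, ∫⁻ s, f (fun a : Fin (n + 1) => Z a ω, s) ∂(Q (Z (n + i) ω)) ∂P := by
      have hs := hZ.step (n + i)
      -- Forgets the coordinates after time `n`.
      let ρ : (Fin (n + i + 1) → S) → (Fin (n + 1) → S) :=
        fun h a => h (Fin.castLE (by omega) a)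
      have hρ : Measurable ρ := by fun_prop
      have hf' : Measurable fun p : (Fin (n + i + 1) → S) × S => f (ρ p.1, p.2) := by fun_prop
      have h2 := congrArg (fun m => ∫⁻ p, f (ρ p.1, p.2) ∂m) hs
      rw [lintegral_map hf' (by fun_prop), Measure.lintegral_compProd hf',
        lintegral_map _ (by fun_prop)] at h2
      · exact h2
      · exact hf'.lintegral_kernel_prod_right' (κ := Q.comap _ (measurable_pi_apply _))
    rw [h1, ih hg]
    refine lintegral_congr fun ω => ?_
    rw [pow_succ']
    exact (Kernel.lintegral_comp Q (Q ^ i) (Z n ω)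
      (g := fun s => f (fun a : Fin (n + 1) => Z a ω, s)) (by fun_prop)).symm

lemma IsMarkovChain.map_eq (hZ : IsMarkovChain P π Q Z) (n i : ℕ) :
    P.map (fun ω => ((fun a : Fin (n + 1) => Z a ω), Z (n + i) ω)) =
      (P.map (fun ω => fun a : Fin (n + 1) => Z a ω)) ⊗ₘ
        ((Q ^ i).comap (fun h : Fin (n + 1) → S => h (Fin.last n)) (measurable_pi_apply _)) := by
  have hZm := hZ.measurable
  refine Measure.ext_of_lintegral _ fun f hf => ?_
  rw [lintegral_map hf (by fun_prop), Measure.lintegral_compProd hf, lintegral_map _ (by fun_prop),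
    hZ.lintegral_eq n i hf]
  · rfl
  · exact hf.lintegral_kernel_prod_right' (κ := (Q ^ i).comap _ (measurable_pi_apply _))

lemma IsMarkovChain.integral_eq (hZ : IsMarkovChain P π Q Z) (n i : ℕ)
    {f : (Fin (n + 1) → S) × S → ℝ} (hf : Measurable f) {c : ℝ} (hc : ∀ p, |f p| ≤ c) :
    ∫ ω, f (fun a : Fin (n + 1) => Z a ω, Z (n + i) ω) ∂P =
      ∫ ω, ∫ s, f (fun a : Fin (n + 1) => Z a ω, s) ∂((Q ^ i) (Z n ω)) ∂P := by
  have hZm := hZ.measurable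
  have h := congrArg (fun m => ∫ p, f p ∂m) (hZ.map_eq n i)
  have : IsProbabilityMeasure (P.map fun ω => fun a : Fin (n + 1) => Z a ω) :=
    Measure.isProbabilityMeasure_map (by fun_prop)
  rw [integral_map (by fun_prop) hf.aestronglyMeasurable,
    Measure.integral_compProd (integrable_of_abs_le hf hc), integral_map (by fun_prop)] at h
  · exact h
  · exact (hf.stronglyMeasurable.integral_kernel_prod_right'
      (κ := (Q ^ i).comap _ (measurable_pi_apply _))).aestronglyMeasurable

end Markov

/-! ### Averages of the oracle along the chain -/

/-- The exponent is constant on blocks of length `τ`, so this is `τ` times a geometric series of sum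
`4/3`. -/
lemma sum_quarter_pow_div_le {τ : ℕ} (hτ : 1 ≤ τ) (m : ℕ) :
    ∑ i ∈ Finset.range m, (1 / 4 : ℝ) ^ (i / τ) ≤ 4 / 3 * τ := by
  have h : ∀ q : ℕ, ∑ i ∈ Finset.range (τ * q), (1 / 4 : ℝ) ^ (i / τ) =
      4 / 3 * τ * (1 - (1 / 4) ^ q) := by
    intro q
    induction q with
    | zero => simp
    | succ q ih =>
      have h1 : ∀ x ∈ Finset.range τ, (1 / 4 : ℝ) ^ ((τ * q + x) / τ) = (1 / 4) ^ q := by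
        intro x hx
        rw [Nat.mul_add_div hτ, Nat.div_eq_of_lt (Finset.mem_range.1 hx), add_zero]
      rw [mul_add, mul_one, Finset.sum_range_add, ih, Finset.sum_congr rfl h1]
      simp only [Finset.sum_const, Finset.card_range, nsmul_eq_mul]
      ring
  calc ∑ i ∈ Finset.range m, (1 / 4 : ℝ) ^ (i / τ)
      ≤ ∑ i ∈ Finset.range (τ * m), (1 / 4 : ℝ) ^ (i / τ) := by
        refine Finset.sum_le_sum_of_subset_of_nonneg ?_ fun _ _ _ => by positivity
        exact Finset.range_subset_range.2 (Nat.le_mul_of_pos_left m hτ)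
    _ = 4 / 3 * τ * (1 - (1 / 4) ^ m) := h m
    _ ≤ 4 / 3 * τ := by
        have h1 : (0 : ℝ) ≤ (1 / 4) ^ m := by positivity
        have h2 : (0 : ℝ) ≤ τ := by positivity
        nlinarith

lemma sum_Icc_quarter_pow_div_le {τ : ℕ} (hτ : 1 ≤ τ) (m : ℕ) :
    ∑ i ∈ Finset.Icc 1 m, (1 / 4 : ℝ) ^ (i / τ) ≤ 4 / 3 * τ :=
  (Finset.sum_le_sum_of_subset_of_nonneg (t := Finset.range (m + 1))
    (fun i hi => by simp only [Finset.mem_Icc, Finset.mem_range] at *; omega)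
    fun _ _ _ => by positivity).trans (sum_quarter_pow_div_le hτ _)

/-- With truncated subtraction, `i - j + (j - i)` is `|i - j|`. On either side of `i` the distance
is injective, so each half is bounded by the previous sum. -/
lemma sum_quarter_pow_dist_div_le {τ : ℕ} (hτ : 1 ≤ τ) (m i : ℕ) :
    ∑ j ∈ Finset.Icc 1 m, (1 / 4 : ℝ) ^ ((i - j + (j - i)) / τ) ≤ 8 / 3 * τ := by
  have key : ∀ (s : Finset ℕ) (g : ℕ → ℕ), Set.InjOn g s → (∀ j ∈ s, g j = i - j + (j - i)) →
      ∑ j ∈ s, (1 / 4 : ℝ) ^ ((i - j + (j - i)) / τ) ≤ 4 / 3 * τ := by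
    intro s g hg hs
    have h1 : ∑ j ∈ s, (1 / 4 : ℝ) ^ ((i - j + (j - i)) / τ) =
        ∑ k ∈ s.image g, (1 / 4 : ℝ) ^ (k / τ) := by
      rw [Finset.sum_image hg]
      exact Finset.sum_congr rfl fun j hj => by rw [hs j hj]
    rw [h1]
    refine (Finset.sum_le_sum_of_subset_of_nonneg (t := Finset.range ((s.image g).sup id + 1))
      (fun k hk => ?_) fun _ _ _ => by positivity).trans (sum_quarter_pow_div_le hτ _)
    exact Finset.mem_range.2 (Nat.lt_succ_of_le (Finset.le_sup (f := id) hk))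
  rw [← Finset.sum_filter_add_sum_filter_not _ (fun j => j ≤ i)]
  have h1 := key ((Finset.Icc 1 m).filter fun j => j ≤ i) (fun j => i - j)
    (fun a ha b hb hab => by simp at ha hb hab; omega) (fun j hj => by simp at hj; omega)
  have h2 := key ((Finset.Icc 1 m).filter fun j => ¬ j ≤ i) (fun j => j - i)
    (fun a ha b hb hab => by simp at ha hb hab; omega) (fun j hj => by simp at hj; omega)
  linarith

/-- The bound `(σ² + Δ² ‖x - xs‖²)^{1/2}` on the noise of the oracle at `x`. -/
noncomputable def noiseBound {d : ℕ} (σ Δ : ℝ) (xs x : RSpace d) : ℝ :=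
  Real.sqrt (σ ^ 2 + Δ ^ 2 * ‖x - xs‖ ^ 2)

lemma noiseBound_nonneg {d : ℕ} (σ Δ : ℝ) (xs x : RSpace d) : 0 ≤ noiseBound σ Δ xs x :=
  Real.sqrt_nonneg _

lemma noiseBound_sq {d : ℕ} (σ Δ : ℝ) (xs x : RSpace d) :
    noiseBound σ Δ xs x ^ 2 = σ ^ 2 + Δ ^ 2 * ‖x - xs‖ ^ 2 := Real.sq_sqrt (by positivity)

lemma noiseBound_le {d : ℕ} (σ Δ : ℝ) {xs x : RSpace d} {K : ℝ} (hK : ‖x - xs‖ ≤ K) :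
    noiseBound σ Δ xs x ≤ Real.sqrt (σ ^ 2 + Δ ^ 2 * K ^ 2) := by
  unfold noiseBound
  gcongr

@[fun_prop]
lemma continuous_noiseBound {d : ℕ} (σ Δ : ℝ) (xs : RSpace d) :
    Continuous (noiseBound σ Δ xs) := by
  unfold noiseBound; fun_prop

@[fun_prop]
lemma measurable_noiseBound {d : ℕ} (σ Δ : ℝ) (xs : RSpace d) :
    Measurable (noiseBound σ Δ xs) := (continuous_noiseBound σ Δ xs).measurable

lemma IsNoisyOracle.norm_le {d : ℕ} {S : Type*} [MeasurableSpace S] {X : Set (RSpace d)}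
    {F : RSpace d → RSpace d} {Fz : RSpace d → S → RSpace d} {π : Measure S} {xs : RSpace d}
    {σ Δ : ℝ} (hO : IsNoisyOracle X F Fz π xs σ Δ) {x : RSpace d} (hx : x ∈ X) (z : S) :
    ‖Fz x z - F x‖ ≤ noiseBound σ Δ xs x := Real.le_sqrt_of_sq_le (hO.growth x hx z)

/-- A bounded `X`-valued function of the sample path that depends on the times `≤ n` only. -/
structure IsAdaptedIn {d : ℕ} {S : Type*} [MeasurableSpace S] (X : Set (RSpace d))
    (xs : RSpace d) (K : ℝ) (n : ℕ) (y : (ℕ → S) → RSpace d) : Prop where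
  measurable : Measurable y
  dependsOn : DependsOn y (Set.Iic n)
  mem : ∀ z, y z ∈ X
  norm_le : ∀ z, ‖y z - xs‖ ≤ K

lemma IsMonotoneVI.measurable_comp {d : ℕ} {X : Set (RSpace d)} {F : RSpace d → RSpace d}
    {r : RSpace d → ℝ} {L μF μr : ℝ} (hVI : IsMonotoneVI X F r L μF μr) {α : Type*}
    [MeasurableSpace α] {y : α → RSpace d} (hy : Measurable y) (hX : ∀ a, y a ∈ X) :
    Measurable fun a => F (y a) := by
  have hF : ContinuousOn F X := by
    refine LipschitzOnWith.continuousOn (K := L.toNNReal) ?_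
    refine LipschitzOnWith.of_dist_le_mul fun x hx y hy => ?_
    rw [dist_eq_norm, dist_eq_norm]
    refine (hVI.lipschitz x hx y hy).trans ?_
    gcongr
    exact Real.le_coe_toNNReal L
  exact hF.domRestrict.measurable.comp (hy.subtype_mk (h := hX))

lemma batchMean_sub {d : ℕ} {S : Type*} {F : RSpace d → RSpace d} {Fz : RSpace d → S → RSpace d}
    {m : ℕ} (hm : 0 < m) (z : ℕ → S) (x : RSpace d) (T : ℕ) :
    batchMean Fz z x T m - F x =
      (m : ℝ)⁻¹ • ∑ i ∈ Finset.Icc 1 m, (Fz x (z (T + i)) - F x) := by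
  have : (m : ℝ) ≠ 0 := by positivity
  rw [batchMean, Finset.sum_sub_distrib, smul_sub, Finset.sum_const, Nat.card_Icc,
    Nat.add_sub_cancel, ← Nat.cast_smul_eq_nsmul ℝ, smul_smul, inv_mul_cancel₀ this, one_smul]

section Moments

variable {d : ℕ} {X : Set (RSpace d)} {F : RSpace d → RSpace d} {r : RSpace d → ℝ}
  {L μF μr : ℝ} {xs : RSpace d} {S : Type*} [MeasurableSpace S] {Q : Kernel S S}
  [IsMarkovKernel Q] {π : Measure S} {Fz : RSpace d → S → RSpace d}
  {σ Δ : ℝ} {τ : ℕ} {ν : Measure (ℕ → S)} [IsProbabilityMeasure ν] {K : ℝ} {n : ℕ}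
  {y : (ℕ → S) → RSpace d}

lemma IsAdaptedIn.measurable_noise (hy : IsAdaptedIn X xs K n y)
    (hVI : IsMonotoneVI X F r L μF μr) (hO : IsNoisyOracle X F Fz π xs σ Δ) (i : ℕ) :
    Measurable fun z : ℕ → S => Fz (y z) (z i) - F (y z) := by
  have h1 : Measurable fun z : ℕ → S => Fz (y z) (z i) :=
    hO.measurable.comp (hy.measurable.prodMk (measurable_pi_apply i))
  exact h1.sub (hVI.measurable_comp hy.measurable hy.mem)

/-- Given the past up to `n`, `y` and `v` are fixed and the sample has law `(Q ^ i) (z n)`. Under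
`π` the noise is centred, so forgetting bounds its conditional mean. The direction `v` is free: `y -
xs` yields the bias, an earlier noise term yields covariances. -/
lemma IsAdaptedIn.abs_integral_inner_noise_le [IsProbabilityMeasure π]
    (hy : IsAdaptedIn X xs K n y)
    (hVI : IsMonotoneVI X F r L μF μr) (hO : IsNoisyOracle X F Fz π xs σ Δ)
    (hQ : IsUniformlyErgodic Q τ) (hπ : Q.Invariant π)
    (hν : IsMarkovChain ν π Q (fun i (z : ℕ → S) => z i)) {v : (ℕ → S) → RSpace d}
    (hv : Measurable v) (hvd : DependsOn v (Set.Iic n)) {V : ℝ} (hV : ∀ z, ‖v z‖ ≤ V) (i : ℕ) :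
    |∫ z, inner ℝ (Fz (y z) (z (n + i)) - F (y z)) (v z) ∂ν| ≤
      2 * (1 / 4) ^ (i / τ) * ∫ z, noiseBound σ Δ xs (y z) * ‖v z‖ ∂ν := by
  -- Extends a finite history by its last entry; functions of the times `≤ n` cannot see the
  -- extension.
  let e : (Fin (n + 1) → S) → (ℕ → S) := fun h a => h ⟨min a n, by omega⟩
  have he : Measurable e := by fun_prop
  have hye : Measurable fun h => y (e h) := hy.measurable.comp he
  have hve : Measurable fun h => v (e h) := hv.comp he
  have hez : ∀ z : ℕ → S, ∀ a ∈ Set.Iic n, e (fun a => z a) a = z a := fun z a ha => by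
    simp only [e, min_eq_left (Set.mem_Iic.1 ha)]
  set C := Real.sqrt (σ ^ 2 + Δ ^ 2 * K ^ 2)
  have hb : ∀ (z : ℕ → S) (s : S), |inner ℝ (Fz (y z) s - F (y z)) (v z)| ≤
      noiseBound σ Δ xs (y z) * ‖v z‖ := fun z s =>
    (abs_real_inner_le_norm _ _).trans
      (mul_le_mul_of_nonneg_right (hO.norm_le (hy.mem z) s) (norm_nonneg _))
  have hC : ∀ z, noiseBound σ Δ xs (y z) * ‖v z‖ ≤ C * V := fun z =>
    mul_le_mul (noiseBound_le σ Δ (hy.norm_le z)) (hV z) (norm_nonneg _) (Real.sqrt_nonneg _)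
  let f : (Fin (n + 1) → S) × S → ℝ := fun p =>
    inner ℝ (Fz (y (e p.1)) p.2 - F (y (e p.1))) (v (e p.1))
  have hf : Measurable f := by
    have h1 : Measurable fun p : (Fin (n + 1) → S) × S => Fz (y (e p.1)) p.2 :=
      hO.measurable.comp ((hye.comp measurable_fst).prodMk measurable_snd)
    have h2 : Measurable fun p : (Fin (n + 1) → S) × S => F (y (e p.1)) :=
      hVI.measurable_comp (hye.comp measurable_fst) fun p => hy.mem _
    exact (h1.sub h2).inner (hve.comp measurable_fst)
  have h1 := hν.integral_eq n i hf (c := C * V) fun p => (hb _ _).trans (hC _)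
  have h2 : ∀ (z : ℕ → S) (s : S), f (fun a : Fin (n + 1) => z a, s) =
      inner ℝ (Fz (y z) s - F (y z)) (v z) := fun z s => by
    simp only [f, hy.dependsOn (hez z), hvd (hez z)]
  simp only [h2] at h1
  rw [h1, ← integral_const_mul]
  refine norm_integral_le_of_norm_le (f := fun z : ℕ → S =>
    ∫ s, inner ℝ (Fz (y z) s - F (y z)) (v z) ∂((Q ^ i) (z n))) ?_ (.of_forall fun z => ?_)
  · refine Integrable.const_mul (integrable_of_abs_le (c := C * V) ?_ fun z => ?_) _
    · have := hy.measurable; fun_prop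
    · rw [abs_of_nonneg (mul_nonneg (noiseBound_nonneg _ _ _ _) (norm_nonneg _))]
      exact hC z
  · have hm : Measurable fun s => Fz (y z) s - F (y z) :=
      (hO.measurable.comp measurable_prodMk_left).sub_const _
    have h3 : ∫ s, inner ℝ (Fz (y z) s - F (y z)) (v z) ∂π = 0 := by
      have hi : Integrable (fun s => Fz (y z) s - F (y z)) π :=
        Integrable.of_bound hm.aestronglyMeasurable _
          (.of_forall fun s => hO.norm_le (hy.mem z) s)
      have hi' : Integrable (fun s => Fz (y z) s) π :=
        (hi.add (integrable_const (F (y z)))).congr (.of_forall fun s => by simp)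
      simp_rw [real_inner_comm (v z)]
      rw [integral_inner hi, integral_sub hi' (integrable_const _), hO.unbiased _ (hy.mem z)]
      simp
    have h4 := hQ.abs_integral_sub_le hπ (h := fun s => inner ℝ (Fz (y z) s - F (y z)) (v z))
      (by fun_prop) (hb z) i (z n)
    rw [h3, sub_zero] at h4
    rw [Real.norm_eq_abs]
    linarith

lemma IsNoisyOracle.norm_batchMean_sub_le (hO : IsNoisyOracle X F Fz π xs σ Δ) {x : RSpace d}
    (hx : x ∈ X) {m : ℕ} (hm : 0 < m) (z : ℕ → S) (T : ℕ) :
    ‖batchMean Fz z x T m - F x‖ ≤ noiseBound σ Δ xs x := by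
  have hm' : (0 : ℝ) < m := by positivity
  rw [batchMean_sub hm, norm_smul, norm_inv, Real.norm_of_nonneg hm'.le, inv_mul_le_iff₀ hm']
  refine (norm_sum_le_of_le _ fun i _ => hO.norm_le hx _).trans ?_
  simp

lemma IsAdaptedIn.measurable_batchMean_sub (hy : IsAdaptedIn X xs K n y)
    (hVI : IsMonotoneVI X F r L μF μr) (hO : IsNoisyOracle X F Fz π xs σ Δ) {m : ℕ}
    (hm : 0 < m) (T : ℕ) : Measurable fun z => batchMean Fz z (y z) T m - F (y z) := by
  simp_rw [batchMean_sub hm]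
  exact (Finset.measurable_fun_sum _ fun i _ => hy.measurable_noise hVI hO (T + i)).const_smul
    (m : ℝ)⁻¹

/-- The bias of a batch mean. -/
lemma IsAdaptedIn.abs_integral_inner_batchMean_le [IsProbabilityMeasure π]
    (hy : IsAdaptedIn X xs K n y)
    (hVI : IsMonotoneVI X F r L μF μr) (hO : IsNoisyOracle X F Fz π xs σ Δ)
    (hQ : IsUniformlyErgodic Q τ) (hπ : Q.Invariant π)
    (hν : IsMarkovChain ν π Q (fun i (z : ℕ → S) => z i)) {m : ℕ} (hm : 0 < m) :
    |∫ z, inner ℝ (batchMean Fz z (y z) n m - F (y z)) (y z - xs) ∂ν| ≤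
      8 / 3 * τ / m * ∫ z, noiseBound σ Δ xs (y z) * ‖y z - xs‖ ∂ν := by
  have hm' : (0 : ℝ) < m := by positivity
  set E := ∫ z, noiseBound σ Δ xs (y z) * ‖y z - xs‖ ∂ν
  have hE : 0 ≤ E := integral_nonneg fun z => mul_nonneg (noiseBound_nonneg _ _ _ _) (norm_nonneg _)
  have hym := hy.measurable
  have hv : Measurable fun z => y z - xs := by fun_prop
  have hint : ∀ i, Integrable (fun z : ℕ → S =>
      inner ℝ (Fz (y z) (z (n + i)) - F (y z)) (y z - xs)) ν := fun i => by
    refine integrable_of_abs_le ((hy.measurable_noise hVI hO (n + i)).inner hv)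
      (c := Real.sqrt (σ ^ 2 + Δ ^ 2 * K ^ 2) * K) fun z => ?_
    refine (abs_real_inner_le_norm _ _).trans (mul_le_mul ?_ (hy.norm_le z) (norm_nonneg _)
      (Real.sqrt_nonneg _))
    exact (hO.norm_le (hy.mem z) _).trans (noiseBound_le σ Δ (hy.norm_le z))
  simp_rw [batchMean_sub hm, real_inner_smul_left, sum_inner]
  rw [integral_const_mul, integral_finsetSum _ fun i _ => hint i, abs_mul,
    abs_of_pos (inv_pos.2 hm')]
  calc (m : ℝ)⁻¹ * |∑ i ∈ Finset.Icc 1 m,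
        ∫ z, inner ℝ (Fz (y z) (z (n + i)) - F (y z)) (y z - xs) ∂ν|
      ≤ (m : ℝ)⁻¹ * ∑ i ∈ Finset.Icc 1 m, 2 * (1 / 4) ^ (i / τ) * E := by
        gcongr
        refine (Finset.abs_sum_le_sum_abs _ _).trans (Finset.sum_le_sum fun i _ => ?_)
        exact hy.abs_integral_inner_noise_le hVI hO hQ hπ hν hv
          (fun z z' h => by simp only [hy.dependsOn h]) hy.norm_le i
    _ = (m : ℝ)⁻¹ * (2 * (∑ i ∈ Finset.Icc 1 m, (1 / 4 : ℝ) ^ (i / τ)) * E) := by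
        rw [← Finset.sum_mul, Finset.mul_sum]
    _ ≤ (m : ℝ)⁻¹ * (2 * (4 / 3 * τ) * E) := by
        gcongr
        exact sum_Icc_quarter_pow_div_le hQ.1 m
    _ = 8 / 3 * τ / m * E := by field_simp; ring

/-- The mean square error of a batch mean. -/
lemma IsAdaptedIn.integral_norm_batchMean_sq_le [IsProbabilityMeasure π]
    (hy : IsAdaptedIn X xs K n y)
    (hVI : IsMonotoneVI X F r L μF μr) (hO : IsNoisyOracle X F Fz π xs σ Δ)
    (hQ : IsUniformlyErgodic Q τ) (hπ : Q.Invariant π)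
    (hν : IsMarkovChain ν π Q (fun i (z : ℕ → S) => z i)) {m : ℕ} (hm : 0 < m) :
    ∫ z, ‖batchMean Fz z (y z) n m - F (y z)‖ ^ 2 ∂ν ≤
      16 / 3 * τ / m * ∫ z, noiseBound σ Δ xs (y z) ^ 2 ∂ν := by
  have hm' : (0 : ℝ) < m := by positivity
  set E := ∫ z, noiseBound σ Δ xs (y z) ^ 2 ∂ν with hE'
  have hE : 0 ≤ E := integral_nonneg fun z => by positivity
  have hym := hy.measurable
  set C := Real.sqrt (σ ^ 2 + Δ ^ 2 * K ^ 2)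
  let ξ : ℕ → (ℕ → S) → RSpace d := fun i z => Fz (y z) (z (n + i)) - F (y z)
  have hξm : ∀ i, Measurable (ξ i) := fun i => hy.measurable_noise hVI hO (n + i)
  have hξb : ∀ i z, ‖ξ i z‖ ≤ noiseBound σ Δ xs (y z) := fun i z => hO.norm_le (hy.mem z) _
  have hbC : ∀ z, noiseBound σ Δ xs (y z) ≤ C := fun z => noiseBound_le σ Δ (hy.norm_le z)
  have hξC : ∀ i z, ‖ξ i z‖ ≤ C := fun i z => (hξb i z).trans (hbC z)
  have hint : ∀ i j, Integrable (fun z => inner ℝ (ξ i z) (ξ j z)) ν := fun i j =>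
    integrable_of_abs_le ((hξm i).inner (hξm j)) (c := C * C) fun z =>
      (abs_real_inner_le_norm _ _).trans
        (mul_le_mul (hξC i z) (hξC j z) (norm_nonneg _) (Real.sqrt_nonneg _))
  have hint2 : Integrable (fun z => noiseBound σ Δ xs (y z) ^ 2) ν :=
    integrable_of_abs_le (by fun_prop) (c := C ^ 2) fun z => by
      rw [abs_of_nonneg (by positivity)]
      exact pow_le_pow_left₀ (noiseBound_nonneg _ _ _ _) (hbC z) 2
  have hlt : ∀ i j, i ≤ j → ∫ z, inner ℝ (ξ j z) (ξ i z) ∂ν ≤ 2 * (1 / 4) ^ ((j - i) / τ) * E := by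
    intro i j hij
    -- The earlier noise `ξ i` is known at time `n + i` and serves as the direction `v`; `ξ j` comes
    -- `j - i` steps later, so covariances decay with the distance.
    have hy' : IsAdaptedIn X xs K (n + i) y :=
      ⟨hy.measurable, hy.dependsOn.mono (Set.Iic_subset_Iic.2 (by omega)), hy.mem, hy.norm_le⟩
    have h := hy'.abs_integral_inner_noise_le hVI hO hQ hπ hν (hξm i) (fun z z' h => ?_)
      (hξC i) (j - i)
    · rw [show n + i + (j - i) = n + j by omega] at h
      refine (le_abs_self _).trans (h.trans ?_)
      gcongr
      refine integral_mono (integrable_of_abs_le (c := C * C) ?_ fun z => ?_) hint2 fun z => ?_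
      · have := hξm i; fun_prop
      · rw [abs_of_nonneg (mul_nonneg (noiseBound_nonneg _ _ _ _) (norm_nonneg _))]
        exact mul_le_mul (hbC z) (hξC i z) (norm_nonneg _) (Real.sqrt_nonneg _)
      · simp only [sq]
        exact mul_le_mul_of_nonneg_left (hξb i z) (noiseBound_nonneg _ _ _ _)
    · simp only [ξ, hy'.dependsOn h, h (n + i) (Set.mem_Iic.2 le_rfl)]
  have hall : ∀ i j, ∫ z, inner ℝ (ξ i z) (ξ j z) ∂ν ≤
      2 * (1 / 4) ^ ((i - j + (j - i)) / τ) * E := by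
    intro i j
    rcases le_total i j with h | h
    · rw [Nat.sub_eq_zero_of_le h, zero_add]
      simp_rw [real_inner_comm (ξ j _)]
      exact hlt i j h
    · rw [Nat.sub_eq_zero_of_le h, add_zero]
      exact hlt j i h
  have e : ∀ z, ‖batchMean Fz z (y z) n m - F (y z)‖ ^ 2 =
      (m : ℝ)⁻¹ ^ 2 * ∑ i ∈ Finset.Icc 1 m, ∑ j ∈ Finset.Icc 1 m, inner ℝ (ξ i z) (ξ j z) := by
    intro z
    rw [batchMean_sub hm, norm_smul, mul_pow, Real.norm_eq_abs, sq_abs,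
      ← real_inner_self_eq_norm_sq, sum_inner]
    simp_rw [inner_sum]
    rfl
  simp_rw [e]
  rw [integral_const_mul, integral_finsetSum _ fun i _ => integrable_finsetSum _ fun j _ => hint i j]
  simp_rw [integral_finsetSum _ fun j _ => hint _ j]
  calc (m : ℝ)⁻¹ ^ 2 * ∑ i ∈ Finset.Icc 1 m, ∑ j ∈ Finset.Icc 1 m, ∫ z, inner ℝ (ξ i z) (ξ j z) ∂ν
      ≤ (m : ℝ)⁻¹ ^ 2 * ∑ i ∈ Finset.Icc 1 m, 2 * (8 / 3 * τ) * E := by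
        gcongr with i hi
        refine (Finset.sum_le_sum fun j _ => hall i j).trans ?_
        rw [← Finset.sum_mul, ← Finset.mul_sum]
        gcongr
        exact sum_quarter_pow_dist_div_le hQ.1 m i
    _ = 16 / 3 * τ / m * E := by
        rw [Finset.sum_const, Nat.card_Icc, Nat.add_sub_cancel, nsmul_eq_mul]
        field_simp
        ring

end Moments

/-! ### One iteration along the chain -/

section Step

variable {d : ℕ} {X : Set (RSpace d)} {F : RSpace d → RSpace d} {r : RSpace d → ℝ}
  {L μF μr : ℝ} {xs : RSpace d} {S : Type*} [MeasurableSpace S]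
  {π : Measure S} {Fz : RSpace d → S → RSpace d} {σ Δ γ M K : ℝ} {n B : ℕ}
  {x y : (ℕ → S) → RSpace d}

lemma IsAdaptedIn.mono (hy : IsAdaptedIn X xs K n y) {n' : ℕ} (h : n ≤ n') :
    IsAdaptedIn X xs K n' y :=
  ⟨hy.measurable, hy.dependsOn.mono (Set.Iic_subset_Iic.2 h), hy.mem, hy.norm_le⟩

lemma dependsOn_batchMean {S : Type*} {Fz : RSpace d → S → RSpace d} {y : (ℕ → S) → RSpace d}
    (hy : DependsOn y (Set.Iic n)) {n' m : ℕ} (h : n + m ≤ n') :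
    DependsOn (fun z => batchMean Fz z (y z) n m) (Set.Iic n') := by
  intro z z' hz
  have h1 : y z = y z' := hy fun i hi => hz i (le_trans (Set.mem_Iic.1 hi) (by omega))
  simp only [batchMean, h1]
  congr 1
  refine Finset.sum_congr rfl fun i hi => ?_
  rw [hz (n + i) (Set.mem_Iic.2 (by simp at hi; omega))]

lemma IsAdaptedIn.measurable_batchMean (hy : IsAdaptedIn X xs K n y)
    (hO : IsNoisyOracle X F Fz π xs σ Δ) (T m : ℕ) :
    Measurable fun z => batchMean Fz z (y z) T m := by
  unfold batchMean
  exact (Finset.measurable_fun_sum _ fun i _ =>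
    hO.measurable.comp (hy.measurable.prodMk (measurable_pi_apply (T + i)))).const_smul (m : ℝ)⁻¹

/-- A qualitative bound by compactness. Such radii only secure integrability and never enter the
rate. -/
lemma exists_norm_proxOn_sub_le (hVI : IsMonotoneVI X F r L μF μr)
    (hs : IsVISolution X F r xs) (hγ : 0 < γ) (hμr : 0 ≤ μr) (K : ℝ) :
    ∃ K', ∀ u : RSpace d, ‖u‖ ≤ K → ‖proxOn X r γ u - xs‖ ≤ K' := by
  have hc : ContinuousOn (fun u => proxOn X r γ u - xs) (Metric.closedBall 0 K) :=
    ((continuous_proxOn hVI hs hγ hμr).sub continuous_const).continuousOn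
  obtain ⟨K', hK'⟩ := (isCompact_closedBall (0 : RSpace d) K).exists_bound_of_continuousOn hc
  exact ⟨K', fun u hu => hK' u (by simpa using hu)⟩

lemma IsMonotoneVI.norm_le (hVI : IsMonotoneVI X F r L μF μr) (hs : xs ∈ X) (hL : 0 ≤ L)
    {u : RSpace d} (hu : u ∈ X) (hK : ‖u - xs‖ ≤ K) : ‖F u‖ ≤ ‖F xs‖ + L * K := by
  have h1 := hVI.lipschitz u hu xs hs
  have h2 := norm_le_norm_add_norm_sub' (F u) (F xs)
  have h3 := mul_le_mul_of_nonneg_left hK hL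
  linarith

/-- A proximal step along an estimate of `F` that is within a bounded distance of `F`. -/
lemma IsAdaptedIn.exists_proxOn (hVI : IsMonotoneVI X F r L μF μr)
    (hs : IsVISolution X F r xs) (hγ : 0 < γ) (hμr : 0 ≤ μr) (hL : 0 ≤ L) (K K₁ C : ℝ) :
    ∃ K', ∀ (n n' n'' : ℕ) (x y g : (ℕ → S) → RSpace d), IsAdaptedIn X xs K n x →
      IsAdaptedIn X xs K₁ n' y → Measurable g → DependsOn g (Set.Iic n'') → n ≤ n'' →
      (∀ z, ‖g z - F (y z)‖ ≤ C) →
      IsAdaptedIn X xs K' n'' (fun z => proxOn X r γ (x z - γ • g z)) := by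
  obtain ⟨K', hK'⟩ := exists_norm_proxOn_sub_le hVI hs hγ hμr
    (‖xs‖ + K + γ * (‖F xs‖ + L * K₁ + C))
  refine ⟨K', fun n n' n'' x y g hx hy hg hgd hn hgC => ⟨?_, ?_, ?_, ?_⟩⟩
  · have := hx.measurable
    exact (continuous_proxOn hVI hs hγ hμr).measurable.comp (this.sub (hg.const_smul γ))
  · intro z z' hz
    simp only [hgd hz, (hx.mono hn).dependsOn hz]
  · exact fun z => proxOn_mem hVI hs hγ _
  · refine fun z => hK' _ ?_
    have h1 := norm_sub_le (x z) (γ • g z)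
    rw [norm_smul, Real.norm_of_nonneg hγ.le] at h1
    have h2 := norm_le_norm_add_norm_sub' (x z) xs
    have h3 := norm_le_norm_add_norm_sub' (g z) (F (y z))
    have h4 := hVI.norm_le hs.1 hL (hy.mem z) (hy.norm_le z)
    have h5 : γ * ‖g z‖ ≤ γ * (‖F xs‖ + L * K₁ + C) :=
      mul_le_mul_of_nonneg_left (by linarith [hgC z]) hγ.le
    linarith [hx.norm_le z]

/-- Writing the truncation as a weight that is `2^j` or `0` makes the error linear in the batch
errors, in one formula for both cases. -/
lemma randomBatchEstimate_sub {S : Type*} {Fz : RSpace d → S → RSpace d} (z : ℕ → S) (u : RSpace d) (T j : ℕ) :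
    randomBatchEstimate Fz z M B u T j - F u = (batchMean Fz z u T B - F u) +
      (if (2 : ℝ) ^ j ≤ M then (2 : ℝ) ^ j else 0) •
        ((batchMean Fz z u T (2 ^ j * B) - F u) - (batchMean Fz z u T (2 ^ (j - 1) * B) - F u)) := by
  unfold randomBatchEstimate
  split_ifs
  · rw [sub_sub_sub_cancel_right]; abel
  · simp

lemma norm_randomBatchEstimate_sub_le (hO : IsNoisyOracle X F Fz π xs σ Δ) (hM : 0 ≤ M)
    (hB : 0 < B) {u : RSpace d} (hu : u ∈ X) (hK : ‖u - xs‖ ≤ K) (z : ℕ → S) (T j : ℕ) :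
    ‖randomBatchEstimate Fz z M B u T j - F u‖ ≤
      (1 + 2 * M) * Real.sqrt (σ ^ 2 + Δ ^ 2 * K ^ 2) := by
  set C := Real.sqrt (σ ^ 2 + Δ ^ 2 * K ^ 2)
  have hb : ∀ m, 0 < m → ‖batchMean Fz z u T m - F u‖ ≤ C := fun m hm =>
    (hO.norm_batchMean_sub_le hu hm z T).trans (noiseBound_le σ Δ hK)
  have h0 : 0 ≤ (if (2 : ℝ) ^ j ≤ M then (2 : ℝ) ^ j else 0) ∧
      (if (2 : ℝ) ^ j ≤ M then (2 : ℝ) ^ j else 0) ≤ M := by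
    split_ifs with h
    · exact ⟨by positivity, h⟩
    · exact ⟨le_rfl, hM⟩
  rw [randomBatchEstimate_sub]
  refine (norm_add_le _ _).trans ?_
  rw [norm_smul, Real.norm_of_nonneg h0.1]
  have h1 : (if (2 : ℝ) ^ j ≤ M then (2 : ℝ) ^ j else 0) *
      ‖(batchMean Fz z u T (2 ^ j * B) - F u) - (batchMean Fz z u T (2 ^ (j - 1) * B) - F u)‖ ≤
      M * (C + C) :=
    mul_le_mul h0.2 ((norm_sub_le _ _).trans
      (add_le_add (hb _ (by positivity)) (hb _ (by positivity)))) (norm_nonneg _) hM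
  linarith [hb B hB]

/-- The extrapolated point. -/
lemma IsAdaptedIn.exists_extrapolation (hVI : IsMonotoneVI X F r L μF μr)
    (hs : IsVISolution X F r xs) (hO : IsNoisyOracle X F Fz π xs σ Δ) (hγ : 0 < γ)
    (hμr : 0 ≤ μr) (hL : 0 ≤ L) (hB : 0 < B) (K : ℝ) :
    ∃ K', ∀ (T : ℕ) (x : (ℕ → S) → RSpace d), IsAdaptedIn X xs K T x →
      IsAdaptedIn X xs K' (T + B)
        (fun z => proxOn X r γ (x z - γ • batchMean Fz z (x z) T B)) := by
  obtain ⟨K', hK'⟩ := IsAdaptedIn.exists_proxOn (S := S) hVI hs hγ hμr hL K K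
    (Real.sqrt (σ ^ 2 + Δ ^ 2 * K ^ 2))
  refine ⟨K', fun T x hx => hK' T T (T + B) x x _ hx hx (hx.measurable_batchMean hO T B)
    (dependsOn_batchMean hx.dependsOn le_rfl) (by omega) fun z => ?_⟩
  exact (hO.norm_batchMean_sub_le (hx.mem z) hB z T).trans (noiseBound_le σ Δ (hx.norm_le z))

lemma IsAdaptedIn.measurable_randomBatchEstimate (hy : IsAdaptedIn X xs K n y)
    (hO : IsNoisyOracle X F Fz π xs σ Δ) (T j : ℕ) :
    Measurable fun z => randomBatchEstimate Fz z M B (y z) T j := by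
  have hm := fun m => hy.measurable_batchMean hO T m
  unfold randomBatchEstimate
  split_ifs
  · exact (hm _).add (((hm _).sub (hm _)).const_smul ((2 : ℝ) ^ j))
  · simpa using hm B

/-- The radius `K'` is chosen before `j`: the cut-off at `M` bounds the weight uniformly, so the
later average over levels integrates a bounded function. -/
lemma IsAdaptedIn.exists_extragradStep (hVI : IsMonotoneVI X F r L μF μr)
    (hs : IsVISolution X F r xs) (hO : IsNoisyOracle X F Fz π xs σ Δ) (hγ : 0 < γ)
    (hμr : 0 ≤ μr) (hL : 0 ≤ L) (hM : 0 ≤ M) (hB : 0 < B) (K : ℝ) :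
    ∃ K', ∀ (T j : ℕ) (x : (ℕ → S) → RSpace d), IsAdaptedIn X xs K T x →
      IsAdaptedIn X xs K' (T + B + 2 ^ j * B)
        (fun z => (extragradStep X r Fz γ M B z j (x z, T)).1) := by
  obtain ⟨K₁, hK₁⟩ := IsAdaptedIn.exists_extrapolation hVI hs hO hγ hμr hL hB K
  obtain ⟨K', hK'⟩ := IsAdaptedIn.exists_proxOn (S := S) hVI hs hγ hμr hL K K₁
    ((1 + 2 * M) * Real.sqrt (σ ^ 2 + Δ ^ 2 * K₁ ^ 2))
  refine ⟨K', fun T j x hx => ?_⟩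
  have hy := hK₁ T x hx
  refine hK' T (T + B) _ x _ (fun z => randomBatchEstimate Fz z M B _ (T + B) j) hx hy
    (hy.measurable_randomBatchEstimate hO _ j) ?_ (by omega)
    fun z => norm_randomBatchEstimate_sub_le hO hM hB (hy.mem z) (hy.norm_le z) z _ j
  have h0 : B ≤ 2 ^ j * B := Nat.le_mul_of_pos_left B (by positivity)
  have h1 : 2 ^ (j - 1) * B ≤ 2 ^ j * B :=
    Nat.mul_le_mul_right B (Nat.pow_le_pow_right (by norm_num) (by omega))
  intro z z' hz
  have hd := fun m (hm : m ≤ 2 ^ j * B) => dependsOn_batchMean (Fz := Fz) hy.dependsOn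
    (n' := T + B + 2 ^ j * B) (m := m) (by omega) hz
  simp only at hd
  simp only [randomBatchEstimate, hd B h0, hd _ h1, hd _ le_rfl]

/-- For fixed levels `j`, the time `T^k` is deterministic, and `x^k` is a bounded function of the
samples up to that time. -/
lemma exists_isAdaptedIn_extragradState (hVI : IsMonotoneVI X F r L μF μr)
    (hs : IsVISolution X F r xs) (hO : IsNoisyOracle X F Fz π xs σ Δ) (hγ : 0 < γ)
    (hμr : 0 ≤ μr) (hL : 0 ≤ L) (hM : 0 ≤ M) (hB : 0 < B) {x₀ : RSpace d} (hx₀ : x₀ ∈ X) (k : ℕ) :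
    ∃ K, ∀ j : ℕ → ℕ, ∃ T, (∀ z, (extragradState X r Fz γ M B x₀ z j k).2 = T) ∧
      IsAdaptedIn X xs K T (fun z => (extragradState X r Fz γ M B x₀ z j k).1) := by
  induction k with
  | zero =>
    exact ⟨‖x₀ - xs‖, fun j => ⟨0, fun _ => rfl, measurable_const, fun _ _ _ => rfl,
      fun _ => hx₀, fun _ => le_rfl⟩⟩
  | succ k ih =>
    obtain ⟨K, hK⟩ := ih
    obtain ⟨K', hK'⟩ := IsAdaptedIn.exists_extragradStep hVI hs hO hγ hμr hL hM hB K
    refine ⟨K', fun j => ?_⟩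
    obtain ⟨T, hT, hx⟩ := hK j
    have e : ∀ z, extragradState X r Fz γ M B x₀ z j k =
        ((extragradState X r Fz γ M B x₀ z j k).1, T) := fun z => Prod.ext rfl (hT z)
    refine ⟨T + B + 2 ^ j k * B, fun z => ?_, ?_⟩
    · rw [extragradState, e z]; rfl
    · have h := hK' T (j k) _ hx
      have e' : ∀ z, (extragradState X r Fz γ M B x₀ z j (k + 1)).1 =
          (extragradStep X r Fz γ M B z (j k)
            ((extragradState X r Fz γ M B x₀ z j k).1, T)).1 := fun z => by
        rw [← e z]; rfl
      simp_rw [e']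
      exact h

end Step

/-! ### Elementary inequalities for one iteration. -/

lemma sum_Icc_sub_pred (β : ℕ → ℝ) (l : ℕ) :
    ∑ j ∈ Finset.Icc 1 l, (β j - β (j - 1)) = β l - β 0 := by
  induction l with
  | zero => simp
  | succ l ih => rw [Finset.sum_Icc_succ_top (by omega), ih, Nat.add_sub_cancel]; ring

lemma norm_sub_sq_le_three_mul {E : Type*} [SeminormedAddCommGroup E] (a b c e : E) :
    ‖a - e‖ ^ 2 ≤ 3 * (‖a - b‖ ^ 2 + ‖b - c‖ ^ 2 + ‖e - c‖ ^ 2) := by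
  have h : ‖a - e‖ ≤ ‖a - b‖ + ‖b - c‖ + ‖e - c‖ := by
    rw [norm_sub_rev e c, show a - e = (a - b) + (b - c) + (c - e) by abel]
    exact norm_add₃_le
  nlinarith [norm_nonneg (a - e), sq_nonneg (‖a - b‖ - ‖b - c‖), sq_nonneg (‖a - b‖ - ‖e - c‖),
    sq_nonneg (‖b - c‖ - ‖e - c‖)]

lemma norm_add_smul_sub_sq_le {E : Type*} [NormedAddCommGroup E] [NormedSpace ℝ E]
    (a b c : E) (t : ℝ) :
    ‖a + t • (b - c)‖ ^ 2 ≤ 2 * ‖a‖ ^ 2 + t ^ 2 * (4 * (‖b‖ ^ 2 + ‖c‖ ^ 2)) := by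
  have h1 := norm_add_le a (t • (b - c))
  have h2 : ‖t • (b - c)‖ ^ 2 = t ^ 2 * ‖b - c‖ ^ 2 := by
    rw [norm_smul, mul_pow, Real.norm_eq_abs, sq_abs]
  have h3 := norm_sub_le b c
  have h4 : ‖b - c‖ ^ 2 ≤ 2 * (‖b‖ ^ 2 + ‖c‖ ^ 2) := by
    nlinarith [norm_nonneg (b - c), sq_nonneg (‖b‖ - ‖c‖)]
  have h5 := mul_le_mul_of_nonneg_left h4 (sq_nonneg t)
  nlinarith [norm_nonneg (a + t • (b - c)), sq_nonneg (‖a‖ - ‖t • (b - c)‖)]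

/-- Completing the square leaves `512 / 9 / (μ M²)` in front of `w²`; the choice of `M` turns this
into at most `57 γ`, a noise term of the same order as the variance. -/
lemma bias_young {γ μ M : ℝ} (hM : 0 < M) (hμ : 0 < μ) (hMγ : 1 ≤ γ * μ * M ^ 2) (w a : ℝ) :
    32 / (3 * M) * (w * a) ≤ μ / 2 * a ^ 2 + 57 * γ * w ^ 2 := by
  have h1 : 0 ≤ (μ * a - 32 / (3 * M) * w) ^ 2 / (2 * μ) := by positivity
  have h2 : (μ * a - 32 / (3 * M) * w) ^ 2 / (2 * μ) =
      μ / 2 * a ^ 2 - 32 / (3 * M) * (w * a) + 512 / 9 / (μ * M ^ 2) * w ^ 2 := by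
    field_simp
    ring
  have h3 : 512 / 9 / (μ * M ^ 2) ≤ 57 * γ := by
    rw [div_le_iff₀ (by positivity)]
    nlinarith
  nlinarith [mul_le_mul_of_nonneg_right h3 (sq_nonneg w)]

/-- Here `D`, `W`, `Y` are the mean squares of `x - xs`, `x - y`, `y - xs`. Half of `γ μ Y` pays for
the bias and a further small part for the `Δ`-noise; the rest, with `W`, dominates `γ μ D / 16`
because `D ≤ 2Y + 2W`. The noise constant is `284 = 3 + 12·16 + 6·16/3 + 57`. -/
lemma contraction_arith {γ μ L Δ σ D W Y A U₀ β₀ β : ℝ} (hγ : 0 < γ) (hμ : 0 < μ) (hL : 0 ≤ L)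
    (hγμ : γ * μ ≤ 1 / 2000) (hγL : γ * L ≤ 1 / 2000) (hγΔ : γ * Δ ^ 2 ≤ μ / 2000) (hD : 0 ≤ D)
    (hW : 0 ≤ W) (hY : 0 ≤ Y) (hA : A ≤ 16 * (σ ^ 2 + Δ ^ 2 * Y))
    (hU₀ : U₀ ≤ 16 / 3 * (σ ^ 2 + Δ ^ 2 * Y))
    (hβ : -(2 * β) ≤ μ / 2 * Y + 57 * γ * (σ ^ 2 + Δ ^ 2 * Y)) (hDW : D ≤ 2 * Y + 2 * W) :
    (1 + 3 * γ ^ 2 * Δ ^ 2) * D + 3 * γ ^ 2 * σ ^ 2 - (1 - 3 * γ ^ 2 * L ^ 2) * W - γ * μ * Y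
      + 6 * γ ^ 2 * U₀ - 2 * γ * β₀ + (12 * γ ^ 2 * A - 2 * γ * (β - β₀)) ≤
      (1 - γ * μ / 16) * D + 284 * γ ^ 2 * σ ^ 2 := by
  have h1 : 12 * γ ^ 2 * A ≤ 12 * γ ^ 2 * (16 * (σ ^ 2 + Δ ^ 2 * Y)) :=
    mul_le_mul_of_nonneg_left hA (by positivity)
  have h2 : 6 * γ ^ 2 * U₀ ≤ 6 * γ ^ 2 * (16 / 3 * (σ ^ 2 + Δ ^ 2 * Y)) :=
    mul_le_mul_of_nonneg_left hU₀ (by positivity)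
  have h3 : γ * -(2 * β) ≤ γ * (μ / 2 * Y + 57 * γ * (σ ^ 2 + Δ ^ 2 * Y)) :=
    mul_le_mul_of_nonneg_left hβ hγ.le
  have h4 : γ * (γ * Δ ^ 2) ≤ γ * (μ / 2000) := mul_le_mul_of_nonneg_left hγΔ hγ.le
  have h5 := mul_le_mul_of_nonneg_right h4 hD
  have h6 := mul_le_mul_of_nonneg_right h4 hY
  have h7 : (γ * L) ^ 2 ≤ 1 / 2000 := by nlinarith [mul_nonneg hγ.le hL]
  have h8 := mul_le_mul_of_nonneg_right h7 hW
  have h9 := mul_le_mul_of_nonneg_right hγμ hW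
  have h10 : γ * μ * D ≤ γ * μ * (2 * Y + 2 * W) :=
    mul_le_mul_of_nonneg_left hDW (mul_nonneg hγ.le hμ.le)
  have h11 : 0 ≤ γ * μ * Y := by positivity
  have h12 : 0 ≤ γ * μ * D := by positivity
  nlinarith

section LinearCombination

variable {α : Type*} [MeasurableSpace α] {ν : Measure α} [IsProbabilityMeasure ν]
  {f₁ f₂ f₃ f₄ f₅ f₆ f₇ f₈ f₉ : α → ℝ}

lemma integrable_linear_combination (h₁ : Integrable f₁ ν) (h₂ : Integrable f₂ ν)
    (h₃ : Integrable f₃ ν) (h₄ : Integrable f₄ ν) (h₅ : Integrable f₅ ν) (h₆ : Integrable f₆ ν)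
    (h₇ : Integrable f₇ ν) (h₈ : Integrable f₈ ν) (h₉ : Integrable f₉ ν)
    (a₁ b a₂ a₃ a₄ a₅ t c p c' : ℝ) :
    Integrable (fun z => (a₁ * f₁ z + b - a₂ * f₂ z - a₃ * f₃ z + a₄ * f₄ z - a₅ * f₅ z) +
      t * (c * (p * (f₆ z + f₇ z)) - c' * (f₈ z - f₉ z))) ν := by
  fun_prop

lemma integral_linear_combination (h₁ : Integrable f₁ ν) (h₂ : Integrable f₂ ν)
    (h₃ : Integrable f₃ ν) (h₄ : Integrable f₄ ν) (h₅ : Integrable f₅ ν) (h₆ : Integrable f₆ ν)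
    (h₇ : Integrable f₇ ν) (h₈ : Integrable f₈ ν) (h₉ : Integrable f₉ ν)
    (a₁ b a₂ a₃ a₄ a₅ t c p c' : ℝ) :
    ∫ z, (a₁ * f₁ z + b - a₂ * f₂ z - a₃ * f₃ z + a₄ * f₄ z - a₅ * f₅ z) +
      t * (c * (p * (f₆ z + f₇ z)) - c' * (f₈ z - f₉ z)) ∂ν =
    (a₁ * (∫ z, f₁ z ∂ν) + b - a₂ * (∫ z, f₂ z ∂ν) - a₃ * (∫ z, f₃ z ∂ν) + a₄ * (∫ z, f₄ z ∂ν)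
      - a₅ * (∫ z, f₅ z ∂ν)) + t * (c * (p * ((∫ z, f₆ z ∂ν) + (∫ z, f₇ z ∂ν)))
      - c' * ((∫ z, f₈ z ∂ν) - (∫ z, f₉ z ∂ν))) := by
  rw [integral_add (by fun_prop) (by fun_prop), integral_sub (by fun_prop) (by fun_prop),
    integral_add (by fun_prop) (by fun_prop), integral_sub (by fun_prop) (by fun_prop),
    integral_sub (by fun_prop) (by fun_prop), integral_add (by fun_prop) (by fun_prop)]
  simp only [integral_const_mul]
  rw [integral_sub (by fun_prop) (by fun_prop)]
  simp only [integral_const_mul]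
  rw [integral_add h₆ h₇, integral_sub h₈ h₉]
  simp

end LinearCombination

/-! ### One iteration with its level averaged out. -/

section Average

variable {d : ℕ} {X : Set (RSpace d)} {F : RSpace d → RSpace d} {r : RSpace d → ℝ}
  {L μF μr : ℝ} {xs : RSpace d} {S : Type*} [MeasurableSpace S] {Q : Kernel S S}
  [IsMarkovKernel Q] {π : Measure S} {Fz : RSpace d → S → RSpace d}
  {σ Δ γ M : ℝ} {τ B l : ℕ} {ν : Measure (ℕ → S)} [IsProbabilityMeasure ν] {K : ℝ} {n T : ℕ}
  {x y : (ℕ → S) → RSpace d}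

/-- The error of one iteration for a fixed level `j`: only the terms that are multiplied by `2^j`
depend on the level. -/
lemma norm_extragradStep_sub_sq_le (hVI : IsMonotoneVI X F r L μF μr)
    (hs : IsVISolution X F r xs) (hO : IsNoisyOracle X F Fz π xs σ Δ) (hγ : 0 < γ)
    (hμF : 0 ≤ μF) (hμr : 0 ≤ μr) (hB : 0 < B) {u v : RSpace d} (hu : u ∈ X)
    (z : ℕ → S) (hv : v = proxOn X r γ (u - γ • batchMean Fz z u T B)) (j : ℕ) :
    ‖(extragradStep X r Fz γ M B z j (u, T)).1 - xs‖ ^ 2 ≤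
      ((1 + 3 * γ ^ 2 * Δ ^ 2) * ‖u - xs‖ ^ 2 + 3 * γ ^ 2 * σ ^ 2
        - (1 - 3 * γ ^ 2 * L ^ 2) * ‖u - v‖ ^ 2 - γ * (μF + μr) * ‖v - xs‖ ^ 2
        + 6 * γ ^ 2 * ‖batchMean Fz z v (T + B) (2 ^ 0 * B) - F v‖ ^ 2
        - 2 * γ * inner ℝ (batchMean Fz z v (T + B) (2 ^ 0 * B) - F v) (v - xs)) +
      (if (2 : ℝ) ^ j ≤ M then (2 : ℝ) ^ j else 0) *
        (12 * γ ^ 2 * (2 ^ j * (‖batchMean Fz z v (T + B) (2 ^ j * B) - F v‖ ^ 2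
          + ‖batchMean Fz z v (T + B) (2 ^ (j - 1) * B) - F v‖ ^ 2))
        - 2 * γ * (inner ℝ (batchMean Fz z v (T + B) (2 ^ j * B) - F v) (v - xs)
          - inner ℝ (batchMean Fz z v (T + B) (2 ^ (j - 1) * B) - F v) (v - xs))) := by
  have hvX : v ∈ X := hv ▸ proxOn_mem hVI hs hγ _
  set h := batchMean Fz z u T B
  set g := randomBatchEstimate Fz z M B v (T + B) j with hg
  have hstep : (extragradStep X r Fz γ M B z j (u, T)).1 = proxOn X r γ (u - γ • g) := by
    rw [hg, hv]; rfl
  have h1 := extragrad_descent hVI hs hγ hμF hμr u h g hv hstep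
  -- Passing through `F u` and `F v` separates the extrapolation noise, bounded pathwise, a
  -- Lipschitz term absorbed by `‖u - v‖²`, and the error of `g`.
  have h2 := norm_sub_sq_le_three_mul h (F u) (F v) g
  have h3 : ‖h - F u‖ ^ 2 ≤ σ ^ 2 + Δ ^ 2 * ‖u - xs‖ ^ 2 := by
    rw [← noiseBound_sq]
    exact pow_le_pow_left₀ (norm_nonneg _) (hO.norm_batchMean_sub_le hu hB z T) 2
  have h4 : ‖F u - F v‖ ^ 2 ≤ L ^ 2 * ‖u - v‖ ^ 2 := by
    rw [← mul_pow]
    exact pow_le_pow_left₀ (norm_nonneg _) (hVI.lipschitz u hu v hvX) 2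
  rw [pow_zero, one_mul]
  have e := randomBatchEstimate_sub (M := M) (B := B) (F := F) (Fz := Fz) z v (T + B) j
  rw [← hg] at e
  set t : ℝ := if (2 : ℝ) ^ j ≤ M then (2 : ℝ) ^ j else 0 with ht
  -- Since `t` is `0` or `2^j`, the quadratic error too is `t` times a level term, the form needed
  -- for averaging.
  have ht2 : t ^ 2 = t * 2 ^ j := by rw [ht]; split_ifs <;> ring
  set e₀ := batchMean Fz z v (T + B) B - F v
  set e₁ := batchMean Fz z v (T + B) (2 ^ j * B) - F v
  set e₂ := batchMean Fz z v (T + B) (2 ^ (j - 1) * B) - F v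
  have h5 : ‖g - F v‖ ^ 2 ≤ 2 * ‖e₀‖ ^ 2 + t * 2 ^ j * (4 * (‖e₁‖ ^ 2 + ‖e₂‖ ^ 2)) := by
    rw [e, ← ht2]; exact norm_add_smul_sub_sq_le _ _ _ _
  have h6 : inner ℝ (g - F v) (v - xs) =
      inner ℝ e₀ (v - xs) + t * (inner ℝ e₁ (v - xs) - inner ℝ e₂ (v - xs)) := by
    rw [e, inner_add_left, real_inner_smul_left, inner_sub_left e₁]
  rw [h6] at h1
  have h7 : γ ^ 2 * ‖h - g‖ ^ 2 ≤ γ ^ 2 * (3 * ((σ ^ 2 + Δ ^ 2 * ‖u - xs‖ ^ 2)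
      + L ^ 2 * ‖u - v‖ ^ 2 + (2 * ‖e₀‖ ^ 2 + t * 2 ^ j * (4 * (‖e₁‖ ^ 2 + ‖e₂‖ ^ 2))))) :=
    mul_le_mul_of_nonneg_left (by linarith) (sq_nonneg γ)
  nlinarith

/-- The expected error of one iteration from `(x, T)`, averaged over the level. The level `j`
enters through `2^j c_j`, whose average is `∑_{j ≤ l} c_j`. -/
lemma IsAdaptedIn.exists_extragradStep_average_le [IsProbabilityMeasure π]
    (hVI : IsMonotoneVI X F r L μF μr) (hs : IsVISolution X F r xs)
    (hO : IsNoisyOracle X F Fz π xs σ Δ) (hQ : IsUniformlyErgodic Q τ) (hπ : Q.Invariant π)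
    (hν : IsMarkovChain ν π Q (fun i (z : ℕ → S) => z i)) (hγ : 0 < γ) (hμF : 0 ≤ μF)
    (hμr : 0 ≤ μr) (hμ : 0 < μF + μr) (hL : 0 ≤ L) (hB : 0 < B)
    (hγμ : γ * (μF + μr) ≤ 1 / 2000) (hγL : γ * L ≤ 1 / 2000)
    (hγΔ : γ * Δ ^ 2 ≤ (μF + μr) / 2000) (hM : 0 < M) (hMγ : 1 ≤ γ * (μF + μr) * M ^ 2)
    (hMl : M ≤ 2 ^ (l + 1)) (hτB : τ ≤ B) (hlB : l * τ ≤ B) (hx : IsAdaptedIn X xs K T x) :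
    ∃ (a : ℝ) (c : ℕ → ℝ), (∀ j : ℕ,
      ∫ z, ‖(extragradStep X r Fz γ M B z j (x z, T)).1 - xs‖ ^ 2 ∂ν ≤
        a + if (2 : ℝ) ^ j ≤ M then (2 : ℝ) ^ j * c j else 0) ∧
      a + ∑ j ∈ Finset.Icc 1 l, c j ≤
        (1 - γ * (μF + μr) / 16) * ∫ z, ‖x z - xs‖ ^ 2 ∂ν + 284 * γ ^ 2 * σ ^ 2 := by
  obtain ⟨K₁, hK₁⟩ := IsAdaptedIn.exists_extrapolation hVI hs hO hγ hμr hL hB K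
  obtain ⟨K₂, hK₂⟩ := IsAdaptedIn.exists_extragradStep hVI hs hO hγ hμr hL hM.le hB K
  set μ := μF + μr with hμd
  have hy := hK₁ T x hx
  set y : (ℕ → S) → RSpace d := fun z => proxOn X r γ (x z - γ • batchMean Fz z (x z) T B)
  have hxm := hx.measurable
  have hym := hy.measurable
  have sq_int : ∀ {f : (ℕ → S) → RSpace d} {C : ℝ}, Measurable f → (∀ z, ‖f z‖ ≤ C) →
      Integrable (fun z => ‖f z‖ ^ 2) ν := fun {f C} hf hC =>
    integrable_of_abs_le (by fun_prop) (c := C ^ 2) fun z => by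
      rw [abs_of_nonneg (by positivity)]
      exact pow_le_pow_left₀ (norm_nonneg _) (hC z) 2
  set C := Real.sqrt (σ ^ 2 + Δ ^ 2 * K₁ ^ 2)
  let e : ℕ → (ℕ → S) → RSpace d := fun j z => batchMean Fz z (y z) (T + B) (2 ^ j * B) - F (y z)
  have hpos : ∀ j, 0 < 2 ^ j * B := fun j => by positivity
  have hem : ∀ j, Measurable (e j) := fun j => hy.measurable_batchMean_sub hVI hO (hpos j) _
  have heC : ∀ j z, ‖e j z‖ ≤ C := fun j z =>
    (hO.norm_batchMean_sub_le (hy.mem z) (hpos j) z _).trans (noiseBound_le σ Δ (hy.norm_le z))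
  have hie : ∀ j, Integrable (fun z => ‖e j z‖ ^ 2) ν := fun j => sq_int (hem j) (heC j)
  have hii : ∀ j, Integrable (fun z => inner ℝ (e j z) (y z - xs)) ν := fun j =>
    integrable_of_abs_le ((hem j).inner (by fun_prop)) (c := C * K₁) fun z =>
      (abs_real_inner_le_norm _ _).trans
        (mul_le_mul (heC j z) (hy.norm_le z) (norm_nonneg _) (Real.sqrt_nonneg _))
  have hix : Integrable (fun z => ‖x z - xs‖ ^ 2) ν := sq_int (by fun_prop) hx.norm_le
  have hiy : Integrable (fun z => ‖y z - xs‖ ^ 2) ν := sq_int (by fun_prop) hy.norm_le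
  have hixy : Integrable (fun z => ‖x z - y z‖ ^ 2) ν :=
    sq_int (by fun_prop) (C := K + K₁) fun z => by
      rw [← sub_sub_sub_cancel_right _ _ xs]
      exact (norm_sub_le _ _).trans (add_le_add (hx.norm_le z) (hy.norm_le z))
  set D := ∫ z, ‖x z - xs‖ ^ 2 ∂ν with hD
  set Y := ∫ z, ‖y z - xs‖ ^ 2 ∂ν with hY
  set W := ∫ z, ‖x z - y z‖ ^ 2 ∂ν with hW
  let U : ℕ → ℝ := fun j => ∫ z, ‖e j z‖ ^ 2 ∂ν
  let β : ℕ → ℝ := fun j => ∫ z, inner ℝ (e j z) (y z - xs) ∂ν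
  -- `a` gathers the terms without a level; `c j` is the factor multiplying the weight, and its
  -- `β`-part telescopes.
  refine ⟨(1 + 3 * γ ^ 2 * Δ ^ 2) * D + 3 * γ ^ 2 * σ ^ 2 - (1 - 3 * γ ^ 2 * L ^ 2) * W
    - γ * μ * Y + 6 * γ ^ 2 * U 0 - 2 * γ * β 0,
    fun j => 12 * γ ^ 2 * (2 ^ j * (U j + U (j - 1))) - 2 * γ * (β j - β (j - 1)),
    fun j => ?_, ?_⟩
  · have hp : ∀ z, _ := fun z => norm_extragradStep_sub_sq_le (M := M) (T := T) hVI hs hO hγ hμF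
      hμr hB (hx.mem z) z (v := y z) rfl j
    have hstep := hK₂ T j x hx
    have hstm := hstep.measurable
    have hI := integral_mono (μ := ν) (sq_int (hstm.sub_const xs) hstep.norm_le)
      (integrable_linear_combination hix hixy hiy (hie 0) (hii 0) (hie j) (hie (j - 1)) (hii j)
        (hii (j - 1)) _ _ _ _ _ _ _ _ _ _) hp
    rw [integral_linear_combination hix hixy hiy (hie 0) (hii 0) (hie j) (hie (j - 1)) (hii j)
        (hii (j - 1))] at hI
    refine hI.trans (le_of_eq ?_)
    rw [ite_mul, zero_mul]
  · set E := ∫ z, noiseBound σ Δ xs (y z) ^ 2 ∂ν with hE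
    have hBr : (0 : ℝ) < B := by exact_mod_cast hB
    have hE0 : 0 ≤ E := integral_nonneg fun z => by positivity
    have hEY : E = σ ^ 2 + Δ ^ 2 * Y := by
      simp_rw [hE, noiseBound_sq]
      rw [integral_add (integrable_const _) (hiy.const_mul _), integral_const_mul]
      simp [Y]
    have hiE : Integrable (fun z => noiseBound σ Δ xs (y z) ^ 2) ν := by
      simp_rw [noiseBound_sq]
      exact (integrable_const _).add (hiy.const_mul _)
    -- The weight `2^j` cancels the gain from the larger batch, so all levels cost the same.
    have hU : ∀ j, 2 ^ j * U j ≤ 16 / 3 * (τ / B) * E := fun j => by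
      have h := hy.integral_norm_batchMean_sq_le hVI hO hQ hπ hν (hpos j)
      have h' := mul_le_mul_of_nonneg_left h (by positivity : (0 : ℝ) ≤ 2 ^ j)
      refine h'.trans (le_of_eq ?_)
      push_cast
      field_simp
      rfl
    have hUsum : ∑ j ∈ Finset.Icc 1 l, (2 : ℝ) ^ j * (U j + U (j - 1)) ≤ 16 * E := by
      have h1 : ∀ j ∈ Finset.Icc 1 l, (2 : ℝ) ^ j * (U j + U (j - 1)) ≤ 16 * (τ / B) * E := by
        intro j hj
        have h2 : (2 : ℝ) ^ j = 2 * 2 ^ (j - 1) := by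
          rw [← pow_succ', Nat.sub_add_cancel (Finset.mem_Icc.1 hj).1]
        have h3 := hU j
        have h4 := hU (j - 1)
        rw [mul_add]
        nth_rewrite 2 [h2]
        linarith
      refine (Finset.sum_le_sum h1).trans ?_
      have h5 : (l : ℝ) * (τ / B) ≤ 1 := by
        rw [← mul_div_assoc, div_le_one hBr]
        exact_mod_cast hlB
      rw [Finset.sum_const, Nat.card_Icc, Nat.add_sub_cancel, nsmul_eq_mul]
      nlinarith [mul_le_mul_of_nonneg_right h5 hE0]
    have hU0 : U 0 ≤ 16 / 3 * E := by
      have h1 := hU 0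
      have h2 : (τ : ℝ) / B ≤ 1 := (div_le_one hBr).2 (by exact_mod_cast hτB)
      rw [pow_zero, one_mul] at h1
      nlinarith [mul_le_mul_of_nonneg_right h2 hE0]
    -- After telescoping, `β 0` cancels with `a` and only the finest level remains; `M ≤ 2^(l+1)`
    -- makes its bias of order `1/M`.
    have hβ : - (2 * β l) ≤ μ / 2 * Y + 57 * γ * E := by
      have h1 := hy.abs_integral_inner_batchMean_le hVI hO hQ hπ hν (hpos l)
      have h2 : (τ : ℝ) / ((2 ^ l * B : ℕ) : ℝ) ≤ 2 / M := by
        rw [div_le_div_iff₀ (by positivity) hM]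
        push_cast
        have h3 : (τ : ℝ) ≤ B := by exact_mod_cast hτB
        rw [pow_succ] at hMl
        nlinarith [mul_le_mul h3 hMl hM.le hBr.le]
      set G := ∫ z, noiseBound σ Δ xs (y z) * ‖y z - xs‖ ∂ν with hG
      have hG0 : 0 ≤ G :=
        integral_nonneg fun z => mul_nonneg (noiseBound_nonneg _ _ _ _) (norm_nonneg _)
      have h4 : 32 / (3 * M) * G ≤ μ / 2 * Y + 57 * γ * E := by
        rw [hG, hY, hE, ← integral_const_mul, ← integral_const_mul, ← integral_const_mul,
          ← integral_add (hiy.const_mul _) (hiE.const_mul _)]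
        refine integral_mono (Integrable.const_mul (integrable_of_abs_le (c := C * K₁)
          (by fun_prop) fun z => ?_) _) ((hiy.const_mul _).add (hiE.const_mul _)) fun z => ?_
        · rw [abs_of_nonneg (mul_nonneg (noiseBound_nonneg _ _ _ _) (norm_nonneg _))]
          exact mul_le_mul (noiseBound_le σ Δ (hy.norm_le z)) (hy.norm_le z) (norm_nonneg _)
            (Real.sqrt_nonneg _)
        · exact bias_young hM hμ hMγ _ _
      have h5 : 8 / 3 * (τ : ℝ) / ((2 ^ l * B : ℕ) : ℝ) * G ≤ 16 / (3 * M) * G := by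
        refine mul_le_mul_of_nonneg_right ?_ hG0
        rw [mul_div_assoc]
        refine (mul_le_mul_of_nonneg_left h2 (by norm_num)).trans (le_of_eq ?_)
        field_simp
        norm_num
      have h6 := neg_abs_le (β l)
      have h7 : 32 / (3 * M) * G = 2 * (16 / (3 * M) * G) := by ring
      have h8 : |β l| ≤ 16 / (3 * M) * G := h1.trans h5
      linarith
    have hDW : D ≤ 2 * Y + 2 * W := by
      rw [hD, hY, hW, ← integral_const_mul, ← integral_const_mul,
        ← integral_add (hiy.const_mul _) (hixy.const_mul _)]
      refine integral_mono hix ((hiy.const_mul _).add (hixy.const_mul _)) fun z => ?_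
      have h1 : ‖x z - xs‖ ≤ ‖x z - y z‖ + ‖y z - xs‖ := norm_sub_le_norm_sub_add_norm_sub _ _ _
      simp only
      nlinarith [norm_nonneg (x z - xs), sq_nonneg (‖x z - y z‖ - ‖y z - xs‖)]
    have hY0 : 0 ≤ Y := integral_nonneg fun z => by positivity
    have hW0 : 0 ≤ W := integral_nonneg fun z => by positivity
    have hD0 : 0 ≤ D := integral_nonneg fun z => by positivity
    rw [Finset.sum_sub_distrib, ← Finset.mul_sum, ← Finset.mul_sum, sum_Icc_sub_pred]
    rw [hEY] at hUsum hU0 hβ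
    refine contraction_arith hγ hμ hL hγμ hγL hγΔ hD0 hW0 hY0 hUsum hU0 hβ hDW

end Average

/-! ### Averaging over the random levels -/

section Levels

variable {Ω : Type*} [MeasurableSpace Ω] {P : Measure Ω} [IsProbabilityMeasure P]

/-- The prescribed masses on positive levels already sum to `1`. -/
lemma IsGeometricSequence.measure_eq_zero {J : ℕ → Ω → ℕ} (hJ : IsGeometricSequence P J)
    (k : ℕ) : P {ω | J k ω = 0} = 0 := by
  have hU : (⋃ j, {ω | J k ω = j}) = Set.univ := by ext ω; simp
  have h1 : ∑' j, P {ω | J k ω = j} = 1 := by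
    rw [← measure_iUnion, hU, measure_univ]
    · intro i j hij
      exact Set.disjoint_left.2 fun ω hi hj => hij (hi.symm.trans hj)
    · exact fun j => hJ.measurable k (measurableSet_singleton j)
  rw [tsum_eq_zero_add' ENNReal.summable] at h1
  simp_rw [hJ.law k] at h1
  rw [ENNReal.tsum_geometric_add_one, ENNReal.one_sub_inv_two, inv_inv,
    ENNReal.inv_mul_cancel two_ne_zero ENNReal.ofNat_ne_top] at h1
  simpa using (ENNReal.add_left_inj ENNReal.one_ne_top).1 (h1.trans (zero_add 1).symm)

/-- The average of `2^J c_J` over the levels with `2^J ≤ M`. -/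
lemma IsGeometricSequence.integral_ite {J : ℕ → Ω → ℕ} (hJ : IsGeometricSequence P J) (k : ℕ)
    {M : ℝ} {l : ℕ} (hl : ∀ i : ℕ, (2 : ℝ) ^ i ≤ M ↔ i ≤ l) (c : ℕ → ℝ) :
    Integrable (fun ω => if (2 : ℝ) ^ J k ω ≤ M then (2 : ℝ) ^ J k ω * c (J k ω) else 0) P ∧
    ∫ ω, (if (2 : ℝ) ^ J k ω ≤ M then (2 : ℝ) ^ J k ω * c (J k ω) else 0) ∂P =
      ∑ j ∈ Finset.Icc 1 l, c j := by
  have hm : ∀ i, MeasurableSet {ω | J k ω = i} :=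
    fun i => hJ.measurable k (measurableSet_singleton i)
  have e : ∀ᵐ ω ∂P, (∑ i ∈ Finset.Icc 1 l,
      {ω | J k ω = i}.indicator (fun _ => (2 : ℝ) ^ i * c i) ω) =
      if (2 : ℝ) ^ J k ω ≤ M then (2 : ℝ) ^ J k ω * c (J k ω) else 0 := by
    have h0 : ∀ᵐ ω ∂P, J k ω ≠ 0 := by
      rw [ae_iff]; simpa using hJ.measure_eq_zero k
    filter_upwards [h0] with ω hω
    simp only [Set.indicator_apply, Set.mem_ofPred_eq, hl]
    rw [Finset.sum_ite_eq]
    exact if_congr (by simp only [Finset.mem_Icc]; omega) rfl rfl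
  have hi : ∀ i, Integrable ({ω | J k ω = i}.indicator (fun _ => (2 : ℝ) ^ i * c i)) P :=
    fun i => (integrable_const _).indicator (hm i)
  refine ⟨(integrable_finsetSum (Finset.Icc 1 l) fun i _ => hi i).congr e, ?_⟩
  rw [← integral_congr_ae e, integral_finsetSum _ fun i _ => hi i]
  refine Finset.sum_congr rfl fun i hi => ?_
  obtain ⟨j, rfl⟩ : ∃ j, i = j + 1 := ⟨i - 1, by have := (Finset.mem_Icc.1 hi).1; omega⟩
  rw [integral_indicator_const _ (hm _), measureReal_def, hJ.law k j]
  simp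

/-- Fubini for independent variables. As `α` is countable, measurability in `v` for each fixed `u`
gives joint measurability. -/
lemma integral_comp_of_indepFun {α β : Type*} [MeasurableSpace α] [MeasurableSpace β]
    [Countable α] [MeasurableSingletonClass α] {U : Ω → α} {V : Ω → β} (hU : Measurable U)
    (hV : Measurable V) (h : IndepFun V U P) {f : β → α → ℝ} (hf : ∀ u, Measurable fun v => f v u)
    {c : ℝ} (hc : ∀ v u, |f v u| ≤ c) :
    ∫ ω, f (V ω) (U ω) ∂P = ∫ ω, ∫ v, f v (U ω) ∂(P.map V) ∂P := by
  have hm : Measurable fun p : β × α => f p.1 p.2 := measurable_from_prod_countable_left hf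
  have : IsProbabilityMeasure (P.map U) := Measure.isProbabilityMeasure_map hU.aemeasurable
  have : IsProbabilityMeasure (P.map V) := Measure.isProbabilityMeasure_map hV.aemeasurable
  have h1 := (indepFun_iff_map_prod_eq_prod_map_map hV.aemeasurable hU.aemeasurable).1 h
  have h2 : ∫ ω, f (V ω) (U ω) ∂P = ∫ p, f p.1 p.2 ∂(P.map fun ω => (V ω, U ω)) :=
    (integral_map (hV.prodMk hU).aemeasurable hm.aestronglyMeasurable).symm
  rw [h2, h1, integral_prod_symm _ (integrable_of_abs_le hm fun p => hc _ _)]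
  exact integral_map hU.aemeasurable (measurable_of_countable _).aestronglyMeasurable

end Levels

/-- The sequence of levels that continues the first `k` levels by zeros. -/
def padLevels {k : ℕ} (w : Fin k → ℕ) : ℕ → ℕ := fun i => if h : i < k then w ⟨i, h⟩ else 0

lemma padLevels_of_lt {k i : ℕ} (j : ℕ → ℕ) (hi : i < k) :
    padLevels (fun a : Fin k => j a) i = j i := by simp [padLevels, hi]

lemma extragradState_congr {d : ℕ} {S : Type*} {X : Set (RSpace d)} {r : RSpace d → ℝ}
    {Fz : RSpace d → S → RSpace d} {γ M : ℝ} {B : ℕ} {x₀ : RSpace d} (z : ℕ → S) {j j' : ℕ → ℕ}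
    {k : ℕ} (h : ∀ i < k, j i = j' i) :
    extragradState X r Fz γ M B x₀ z j k = extragradState X r Fz γ M B x₀ z j' k := by
  induction k with
  | zero => rfl
  | succ k ih =>
    rw [extragradState, extragradState, ih fun i hi => h i (by omega), h k (by omega)]

/-- A recursion for the expectation of functionals `f k` of an input `Zp` and of the first `k`
levels: it is enough to average over the level `k` with the previous levels fixed. -/
lemma integral_le_of_level_recursion {Ω β : Type*} [MeasurableSpace Ω] [MeasurableSpace β]
    {P : Measure Ω} [IsProbabilityMeasure P] {Zp : Ω → β} (hZm : Measurable Zp)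
    {J : ℕ → Ω → ℕ} (hJ : IsGeometricSequence P J) (hZJ : IndepFun Zp (fun ω k => J k ω) P)
    {f : ℕ → β → (ℕ → ℕ) → ℝ} {K : ℕ → ℝ} (hfm : ∀ k j, Measurable fun z => f k z j)
    (hfb : ∀ k z j, |f k z j| ≤ K k)
    (hfc : ∀ k z j j', (∀ i < k, j i = j' i) → f k z j = f k z j') {q b : ℝ}
    (hstep : ∀ k (j : ℕ → ℕ),
      ∫ ω, ∫ z, f (k + 1) z (Function.update j k (J k ω)) ∂(P.map Zp) ∂P ≤
        q * ∫ z, f k z j ∂(P.map Zp) + b) (k : ℕ) :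
    Integrable (fun ω => f k (Zp ω) fun i => J i ω) P ∧
      ∫ ω, f (k + 1) (Zp ω) (fun i => J i ω) ∂P ≤
        q * ∫ ω, f k (Zp ω) (fun i => J i ω) ∂P + b := by
  have hJm : ∀ k, Measurable (J k) := hJ.measurable
  have : IsProbabilityMeasure (P.map Zp) := Measure.isProbabilityMeasure_map hZm.aemeasurable
  -- Unlike `ℕ → ℕ`, the type `Fin k → ℕ` is countable, so functions of the first `k` levels are
  -- automatically measurable.
  let U : ∀ k, Ω → Fin k → ℕ := fun k ω a => J a ω
  have hU : ∀ k, Measurable (U k) := fun k => by fun_prop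
  have hUpad : ∀ k ω i, i < k → padLevels (U k ω) i = J i ω :=
    fun k ω i hi => padLevels_of_lt (fun i => J i ω) hi
  have hZU : ∀ k, IndepFun (Zp) (U k) P := fun k =>
    hZJ.comp (φ := id) (ψ := fun (j : ℕ → ℕ) (a : Fin k) => j a) measurable_id (by fun_prop)
  have hJU : ∀ k, IndepFun (J k) (U k) P := fun k => by
    have h := hJ.indep.indepFun_finset {k} (Finset.range k) (by simp) hJm
    exact h.comp (φ := fun w : ({k} : Finset ℕ) → ℕ => w ⟨k, by simp⟩)
      (ψ := fun (w : Finset.range k → ℕ) (a : Fin k) => w ⟨a, by simp⟩) (by fun_prop)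
      (by fun_prop)
  let G : ℕ → (ℕ → ℕ) → ℝ := fun k j => ∫ z, f k z j ∂(P.map Zp)
  have hGb : ∀ k j, |G k j| ≤ K k := fun k j => by
    simpa using norm_integral_le_of_norm_le_const (μ := P.map Zp) (f := fun z => f k z j)
      (.of_forall fun z => hfb k z j)
  have hGc : ∀ k j j', (∀ i < k, j i = j' i) → G k j = G k j' := fun k j j' h =>
    integral_congr_ae (.of_forall fun z => hfc k z j j' h)
  have hGi : ∀ k, Integrable (fun ω => G k (padLevels (U k ω))) P := fun k =>
    integrable_of_abs_le ((measurable_of_countable fun w => G k (padLevels w)).comp (hU k))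
      fun ω => hGb k _
  have hfG : ∀ k, ∫ ω, f k (Zp ω) (fun i => J i ω) ∂P =
      ∫ ω, G k (padLevels (U k ω)) ∂P := fun k => by
    rw [← integral_comp_of_indepFun (hU k) hZm (hZU k) (f := fun z w => f k z (padLevels w))
      (fun w => hfm k _) fun z w => hfb k z _]
    exact integral_congr_ae (.of_forall fun ω => hfc _ _ _ _ fun i hi => (hUpad k ω i hi).symm)
  have hrec : ∀ k, ∫ ω, G (k + 1) (padLevels (U (k + 1) ω)) ∂P ≤
      q * ∫ ω, G k (padLevels (U k ω)) ∂P + b := fun k => by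
    have h1 : ∀ ω, G (k + 1) (padLevels (U (k + 1) ω)) =
        G (k + 1) (Function.update (padLevels (U k ω)) k (J k ω)) := fun ω =>
      hGc _ _ _ fun i hi => by
        rw [hUpad _ _ _ hi]
        rcases eq_or_ne i k with rfl | hne
        · rw [Function.update_self]
        · rw [Function.update_of_ne hne, hUpad _ _ _ (by omega)]
    simp_rw [h1]
    -- Level `k` is independent of the earlier ones and is integrated first, with those frozen in
    -- `w`.
    rw [integral_comp_of_indepFun (hU k) (hJm k) (hJU k)
      (f := fun i w => G (k + 1) (Function.update (padLevels w) k i))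
      (fun w => measurable_of_countable _) fun i w => hGb _ _, ← integral_const_mul]
    have h2 : b = ∫ ω, b ∂P := by simp
    rw [h2, ← integral_add ((hGi k).const_mul _) (integrable_const _)]
    have h3 : ∀ w : Fin k → ℕ, ∫ i, G (k + 1) (Function.update (padLevels w) k i) ∂(P.map (J k)) =
        ∫ ω, G (k + 1) (Function.update (padLevels w) k (J k ω)) ∂P := fun w =>
      integral_map (hJm k).aemeasurable (measurable_of_countable _).aestronglyMeasurable
    refine integral_mono (integrable_of_abs_le (c := K (k + 1)) ((measurable_of_countable
      fun w : Fin k → ℕ => ∫ i, G (k + 1) (Function.update (padLevels w) k i) ∂(P.map (J k))).comp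
      (hU k)) fun ω => ?_) (((hGi k).const_mul _).add (integrable_const _)) fun ω => ?_
    · simp only [h3]
      simpa using norm_integral_le_of_norm_le_const (μ := P)
        (f := fun ω' => G (k + 1) (Function.update (padLevels (U k ω)) k (J k ω')))
        (.of_forall fun ω' => hGb _ _)
    · exact (h3 _).trans_le (hstep k _)
  refine ⟨?_, ?_⟩
  · have hm : Measurable fun p : β × (Fin k → ℕ) => f k p.1 (padLevels p.2) :=
      measurable_from_prod_countable_left fun w => hfm k (padLevels w)
    refine (integrable_of_abs_le (hm.comp (hZm.prodMk (hU k))) fun ω => hfb k _ _).congr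
      (.of_forall fun ω => ?_)
    exact hfc _ _ _ _ fun i hi => hUpad k ω i hi
  · rw [hfG, hfG]
    exact hrec k

/-! ### The full run: mean square error and expected cost. -/

section Method

variable {d : ℕ} {X : Set (RSpace d)} {F : RSpace d → RSpace d} {r : RSpace d → ℝ}
  {L μF μr : ℝ} {xs x₀ : RSpace d} {S : Type*} [MeasurableSpace S] {Q : Kernel S S}
  [IsMarkovKernel Q] {π : Measure S} [IsProbabilityMeasure π] {Fz : RSpace d → S → RSpace d}
  {σ Δ γ M : ℝ} {τ B l : ℕ}

/-- The mean square error after `N` iterations of the method. -/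
lemma integral_norm_extragradState_sub_sq_le
    (hVI : IsMonotoneVI X F r L μF μr) (hs : IsVISolution X F r xs) (hx₀ : x₀ ∈ X)
    (hO : IsNoisyOracle X F Fz π xs σ Δ) (hQ : IsUniformlyErgodic Q τ) (hπ : Q.Invariant π)
    (hγ : 0 < γ) (hμF : 0 ≤ μF) (hμr : 0 ≤ μr) (hμ : 0 < μF + μr) (hL : 0 ≤ L) (hB : 0 < B)
    (hγμ : γ * (μF + μr) ≤ 1 / 2000) (hγL : γ * L ≤ 1 / 2000)
    (hγΔ : γ * Δ ^ 2 ≤ (μF + μr) / 2000) (hM : 0 < M) (hMγ : 1 ≤ γ * (μF + μr) * M ^ 2)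
    (hl : ∀ i : ℕ, (2 : ℝ) ^ i ≤ M ↔ i ≤ l) (hτB : τ ≤ B) (hlB : l * τ ≤ B)
    {Ω : Type*} [MeasurableSpace Ω] {P : Measure Ω} [IsProbabilityMeasure P] {Z : ℕ → Ω → S}
    {J : ℕ → Ω → ℕ} (hZ : IsMarkovChain P π Q Z) (hJ : IsGeometricSequence P J)
    (hZJ : IndepFun (fun ω n => Z n ω) (fun ω k => J k ω) P) (N : ℕ) :
    Integrable (fun ω => ‖(extragradState X r Fz γ M B x₀ (fun n => Z n ω)
      (fun k => J k ω) N).1 - xs‖ ^ 2) P ∧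
    ∫ ω, ‖(extragradState X r Fz γ M B x₀ (fun n => Z n ω) (fun k => J k ω) N).1 - xs‖ ^ 2 ∂P ≤
      (1 - γ * (μF + μr) / 16) ^ N * ‖x₀ - xs‖ ^ 2 + 4544 * γ * σ ^ 2 / (μF + μr) := by
  set μ := μF + μr
  have hZm : Measurable fun ω n => Z n ω := measurable_pi_lambda _ hZ.measurable
  have hJm : ∀ k, Measurable (J k) := hJ.measurable
  set ν := P.map fun ω n => Z n ω with hν'
  have : IsProbabilityMeasure ν := Measure.isProbabilityMeasure_map hZm.aemeasurable
  -- The chain is transported to its path space, where adaptedness is dependence on coordinates.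
  have hν : IsMarkovChain ν π Q (fun i (z : ℕ → S) => z i) := by
    refine ⟨fun n => measurable_pi_apply n, ?_, fun n => ?_⟩
    · rw [hν', Measure.map_map (measurable_pi_apply 0) hZm]
      exact hZ.initial
    · rw [hν', Measure.map_map (by fun_prop) hZm, Measure.map_map (by fun_prop) hZm]
      exact hZ.step n
  choose K hK using exists_isAdaptedIn_extragradState hVI hs hO hγ hμr hL hM.le hB hx₀
  choose T hT hA using hK
  let f : ℕ → (ℕ → S) → (ℕ → ℕ) → ℝ :=
    fun k z j => ‖(extragradState X r Fz γ M B x₀ z j k).1 - xs‖ ^ 2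
  have hfm : ∀ k j, Measurable fun z => f k z j := fun k j => by
    have := (hA k j).measurable
    fun_prop
  have hfb : ∀ k z j, |f k z j| ≤ K k ^ 2 := fun k z j => by
    rw [abs_of_nonneg (by positivity)]
    exact pow_le_pow_left₀ (norm_nonneg _) ((hA k j).norm_le z) 2
  have hfc : ∀ k z j j', (∀ i < k, j i = j' i) → f k z j = f k z j' := fun k z j j' h => by
    simp only [f, extragradState_congr z h]
  have hstep : ∀ k (j : ℕ → ℕ), ∫ ω, ∫ z, f (k + 1) z (Function.update j k (J k ω)) ∂ν ∂P ≤
      (1 - γ * μ / 16) * (∫ z, f k z j ∂ν) + 284 * γ ^ 2 * σ ^ 2 := fun k j => by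
    obtain ⟨a, c, hac, hsum⟩ := (hA k j).exists_extragradStep_average_le hVI hs hO hQ hπ hν hγ
      hμF hμr hμ hL hB hγμ hγL hγΔ hM hMγ (le_of_not_ge fun h => by
        have := (hl (l + 1)).1 h; omega) hτB hlB
    let G : ℕ → (ℕ → ℕ) → ℝ := fun k j => ∫ z, f k z j ∂ν
    have hGb : ∀ k j, |G k j| ≤ K k ^ 2 := fun k j => by
      simpa using norm_integral_le_of_norm_le_const (μ := ν) (f := fun z => f k z j)
        (.of_forall fun z => hfb k z j)
    have hle : ∀ i, G (k + 1) (Function.update j k i) ≤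
        a + if (2 : ℝ) ^ i ≤ M then (2 : ℝ) ^ i * c i else 0 := fun i => by
      refine le_of_eq_of_le (integral_congr_ae (.of_forall fun z => ?_)) (hac i)
      have h1 : extragradState X r Fz γ M B x₀ z (Function.update j k i) k =
          ((extragradState X r Fz γ M B x₀ z j k).1, T k j) :=
        (extragradState_congr z fun a ha => Function.update_of_ne (by omega) _ _).trans
          (Prod.ext rfl (hT k j z))
      simp only [f, extragradState, h1, Function.update_self]
    obtain ⟨hi, hI⟩ := hJ.integral_ite k hl c
    have hai : Integrable (fun ω => a + if (2 : ℝ) ^ J k ω ≤ M then (2 : ℝ) ^ J k ω * c (J k ω)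
        else 0) P := (integrable_const a).add hi
    refine (integral_mono (integrable_of_abs_le ((measurable_of_countable fun i =>
      G (k + 1) (Function.update j k i)).comp (hJm k)) fun ω => hGb _ _)
      (hai) fun ω => hle _).trans ?_
    rw [integral_add (integrable_const a) hi, hI]
    simpa using hsum
  have hrec := integral_le_of_level_recursion hZm hJ hZJ hfm hfb hfc hstep
  refine ⟨(hrec N).1, ?_⟩
  show ∫ ω, f N (fun n => Z n ω) (fun k => J k ω) ∂P ≤ _
  induction N with
  | zero =>
    have h1 : 0 ≤ 4544 * γ * σ ^ 2 / μ := by positivity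
    simpa [f, extragradState] using h1
  | succ k ih =>
    refine (hrec k).2.trans ?_
    have h0 : 0 ≤ 1 - γ * μ / 16 := by linarith
    have h1 := mul_le_mul_of_nonneg_left ih h0
    -- `4544 γ σ² / μ`, with `4544 = 16·284`, is the fixed point of the one-step recursion.
    refine (add_le_add_left h1 _).trans (le_of_eq ?_)
    field_simp
    ring

/-- The expected number of oracle calls. -/
lemma integral_oracleCalls_le {Ω : Type*} [MeasurableSpace Ω] {P : Measure Ω}
    [IsProbabilityMeasure P] {J : ℕ → Ω → ℕ} (hJ : IsGeometricSequence P J)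
    (hl : ∀ i : ℕ, (2 : ℝ) ^ i ≤ M ↔ i ≤ l) (B N : ℕ) :
    Integrable (fun ω => oracleCalls M B (fun k => J k ω) N) P ∧
      ∫ ω, oracleCalls M B (fun k => J k ω) N ∂P ≤ N * ((l + 2) * B) := by
  -- Taking out `2 * B` gives the excess cost the form `2^i c_i`, whose average is a plain sum.
  have e : ∀ i : ℕ, ((B : ℝ) + if (2 : ℝ) ^ i ≤ M then (2 : ℝ) ^ i * B else B) =
      2 * B + if (2 : ℝ) ^ i ≤ M then (2 : ℝ) ^ i * (B - B / 2 ^ i) else 0 := fun i => by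
    split_ifs
    · field_simp; ring
    · ring
  unfold oracleCalls
  simp_rw [e]
  have hi : ∀ k, Integrable (fun ω => (2 * B : ℝ) +
      if (2 : ℝ) ^ J k ω ≤ M then (2 : ℝ) ^ J k ω * (B - B / 2 ^ J k ω) else 0) P := fun k =>
    (integrable_const _).add (hJ.integral_ite k hl fun i => B - B / 2 ^ i).1
  refine ⟨integrable_finsetSum _ fun k _ => hi k, ?_⟩
  rw [integral_finsetSum _ fun k _ => hi k]
  refine (Finset.sum_le_card_nsmul _ _ ((l + 2) * B : ℝ) fun k _ => ?_).trans (by simp)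
  obtain ⟨h1, h2⟩ := hJ.integral_ite k hl fun i => B - B / 2 ^ i
  rw [integral_add (integrable_const _) h1, h2]
  have h3 : ∑ i ∈ Finset.Icc 1 l, ((B : ℝ) - B / 2 ^ i) ≤ ∑ i ∈ Finset.Icc 1 l, (B : ℝ) :=
    Finset.sum_le_sum fun i _ => sub_le_self _ (by positivity)
  rw [Finset.sum_const, Nat.card_Icc, Nat.add_sub_cancel, nsmul_eq_mul] at h3
  simp only [integral_const, probReal_univ, smul_eq_mul, one_mul]
  linarith

end Method

/-! ### The parameters -/

section Parameters

variable {μ L Δ σ R ε : ℝ} {N : ℕ}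

lemma one_le_condNumber (hμ : 0 < μ) (hL : 0 < L) (hΔ : 0 ≤ Δ) : 1 ≤ condNumber μ L Δ := by
  unfold condNumber
  have h1 : 0 ≤ L / μ + Δ / μ + Δ ^ 2 / μ ^ 2 := by positivity
  linarith

lemma max_le_mul_condNumber (hμ : 0 < μ) (hL : 0 < L) (hΔ : 0 ≤ Δ) :
    max (max μ L) (max (Δ ^ 2 / μ) Δ) ≤ μ * condNumber μ L Δ := by
  have e : μ * condNumber μ L Δ = μ + L + Δ + Δ ^ 2 / μ := by
    unfold condNumber; field_simp
  have h1 : 0 ≤ Δ ^ 2 / μ := by positivity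
  rw [e]
  refine max_le (max_le ?_ ?_) (max_le ?_ ?_) <;> linarith

lemma stepsize_le {c₁ c₂ : ℝ} :
    stepsize c₁ c₂ μ L Δ σ R N ≤ c₁ / max (max μ L) (max (Δ ^ 2 / μ) Δ) := by
  unfold stepsize
  split_ifs
  · exact le_rfl
  · exact min_le_left _ _

lemma stepsize_pos {c₁ c₂ : ℝ} (hc₁ : 0 < c₁) (hc₂ : 0 < c₂) (hμ : 0 < μ) :
    0 < stepsize c₁ c₂ μ L Δ σ R N := by
  have h1 : 0 < c₁ / max (max μ L) (max (Δ ^ 2 / μ) Δ) :=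
    div_pos hc₁ (lt_max_of_lt_left (lt_max_of_lt_left hμ))
  unfold stepsize
  split_ifs with h
  · exact h1
  · push Not at h
    have hN : (0 : ℝ) < N := by exact_mod_cast Nat.pos_of_ne_zero h.2
    refine lt_min h1 (mul_pos (by positivity) (Real.log_pos ?_))
    exact lt_of_lt_of_le one_lt_two (le_max_left _ _)

lemma half_le_log_two : (1 / 2 : ℝ) ≤ Real.log 2 := by linarith [Real.log_two_gt_d9]

/-- `1 / (γ μ)` grows at most linearly in the condition number and in `N`. -/
lemma inv_stepsize_mul_le (hμ : 0 < μ) (hL : 0 < L) (hΔ : 0 ≤ Δ) :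
    1 / (stepsize (1 / 2000) 16 μ L Δ σ R N * μ) ≤ 2000 * condNumber μ L Δ + N := by
  have hκ := one_le_condNumber hμ hL hΔ
  have hm := max_le_mul_condNumber hμ hL hΔ
  have hm0 : 0 < max (max μ L) (max (Δ ^ 2 / μ) Δ) := lt_max_of_lt_left (lt_max_of_lt_left hμ)
  have h1 : 1 / (1 / 2000 / max (max μ L) (max (Δ ^ 2 / μ) Δ) * μ) ≤
      2000 * condNumber μ L Δ := by
    rw [div_le_iff₀ (by positivity)]
    set m := max (max μ L) (max (Δ ^ 2 / μ) Δ)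
    have e : 2000 * condNumber μ L Δ * (1 / 2000 / m * μ) = μ * condNumber μ L Δ / m := by
      field_simp
    rw [e, one_le_div hm0]
    exact hm
  unfold stepsize
  split_ifs with h
  · have : (0 : ℝ) ≤ N := by positivity
    linarith
  · push Not at h
    have hN : (0 : ℝ) < N := by exact_mod_cast Nat.pos_of_ne_zero h.2
    rcases min_choice (1 / 2000 / max (max μ L) (max (Δ ^ 2 / μ) Δ))
      (16 / (N * μ) * Real.log (max 2 (μ ^ 2 * N * R ^ 2 / σ ^ 2))) with h' | h' <;> rw [h']
    · linarith
    · have hlog : 1 / 2 ≤ Real.log (max 2 (μ ^ 2 * N * R ^ 2 / σ ^ 2)) :=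
        half_le_log_two.trans (Real.log_le_log two_pos (le_max_left _ _))
      set ℓ := Real.log (max 2 (μ ^ 2 * N * R ^ 2 / σ ^ 2))
      have h2 : 1 / (16 / (N * μ) * ℓ * μ) ≤ N := by
        rw [div_le_iff₀ (by positivity)]
        have e : (N : ℝ) * (16 / (N * μ) * ℓ * μ) = 16 * ℓ := by field_simp
        rw [e]; linarith
      linarith

lemma log_two_add_le {u : ℝ} (hu : 10 ^ 14 ≤ u) : Real.log (2 + u) ≤ u / 10 ^ 6 := by
  have h0 : 0 ≤ 2 + u := by linarith
  have h1 : Real.log (2 + u) = 2 * Real.log (Real.sqrt (2 + u)) := by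
    rw [Real.log_sqrt h0]; ring
  have h2 := Real.log_le_self (Real.sqrt_nonneg (2 + u))
  have h3 : Real.sqrt (2 + u) ≤ u / (2 * 10 ^ 6) := by
    rw [Real.sqrt_le_left (by positivity)]
    nlinarith
  rw [h1]
  linarith

/-- Controls the initial error when the stepsize is capped by the problem constants. -/
lemma exp_neg_mul_log_le {ρ : ℝ} (hρ : 0 ≤ ρ) {t : ℝ} (ht : 2 * Real.log (2 + ρ) ≤ t) :
    Real.exp (-t) * ρ ≤ 1 / 2 := by
  have h1 : Real.exp (-t) ≤ ((2 + ρ) ^ 2)⁻¹ := by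
    rw [← Real.exp_log (by positivity : 0 < ((2 + ρ) ^ 2)⁻¹), Real.log_inv, Real.log_pow]
    exact Real.exp_le_exp.2 (by push_cast; linarith)
  refine (mul_le_mul_of_nonneg_right h1 hρ).trans ?_
  rw [inv_mul_le_iff₀ (by positivity)]
  nlinarith

/-- Controls the initial error when the logarithmic term determines the stepsize. -/
lemma exp_neg_log_max_mul_le {u ρ : ℝ} (hu : 2 ≤ u) (hρ : 0 ≤ ρ) :
    Real.exp (-Real.log (max 2 (u * ρ))) * ρ ≤ 1 / 2 := by
  have h0 : 0 < max 2 (u * ρ) := lt_max_of_lt_left two_pos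
  rw [Real.exp_neg, Real.exp_log h0, inv_mul_le_iff₀ h0]
  have := le_max_right 2 (u * ρ)
  nlinarith

/-- With this number of iterations the method reaches accuracy `ε`. -/
lemma accuracy_le (hμ : 0 < μ) (hL : 0 < L) (hΔ : 0 ≤ Δ) (hε : 0 < ε) (hN0 : N ≠ 0)
    (hN : 10 ^ 14 * (condNumber μ L Δ * Real.log (2 + R ^ 2 / ε) + noiseLevel μ σ ε *
      Real.log (2 + condNumber μ L Δ + noiseLevel μ σ ε + R ^ 2 / ε)) ≤ N) :
    Real.exp (-(stepsize (1 / 2000) 16 μ L Δ σ R N * μ / 16 * N)) * R ^ 2 +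
      4544 * stepsize (1 / 2000) 16 μ L Δ σ R N * σ ^ 2 / μ ≤ ε := by
  have hκ := one_le_condNumber hμ hL hΔ
  have hm := max_le_mul_condNumber hμ hL hΔ
  have hm0 : 0 < max (max μ L) (max (Δ ^ 2 / μ) Δ) := lt_max_of_lt_left (lt_max_of_lt_left hμ)
  set m := max (max μ L) (max (Δ ^ 2 / μ) Δ) with hmd
  set κ := condNumber μ L Δ
  set s := noiseLevel μ σ ε with hs
  set ρ := R ^ 2 / ε with hρd
  have hρ : 0 ≤ ρ := by positivity
  have hs0 : 0 ≤ s := by rw [hs, noiseLevel]; positivity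
  have hR : R ^ 2 = ρ * ε := by rw [hρd]; field_simp
  have hℓ : 0 ≤ Real.log (2 + ρ) := Real.log_nonneg (by linarith)
  set Λ := Real.log (2 + κ + s + ρ)
  have hℓΛ : Real.log (2 + ρ) ≤ Λ := Real.log_le_log (by linarith) (by linarith)
  have hΛ1 : 1 ≤ Λ := by
    rw [Real.le_log_iff_exp_le (by linarith)]
    linarith [Real.exp_one_lt_d9]
  have hsΛ : 0 ≤ s * Λ := by positivity
  have hκℓ : 0 ≤ κ * Real.log (2 + ρ) := by positivity
  have hNr : (0 : ℝ) < N := by exact_mod_cast Nat.pos_of_ne_zero hN0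
  have hA : Real.exp (-(1 / 2000 / m * μ / 16 * N)) * ρ ≤ 1 / 2 := by
    refine exp_neg_mul_log_le hρ ?_
    have h1 : 2 * Real.log (2 + ρ) * (32000 * m) ≤ μ * N := by
      calc 2 * Real.log (2 + ρ) * (32000 * m) ≤ 2 * Real.log (2 + ρ) * (32000 * (μ * κ)) := by
            gcongr
        _ = μ * (64000 * (κ * Real.log (2 + ρ))) := by ring
        _ ≤ μ * N := by gcongr; linarith
    have e : 1 / 2000 / m * μ / 16 * N = μ * N / (32000 * m) := by field_simp; norm_num
    rw [e, le_div_iff₀ (by positivity)]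
    exact h1
  by_cases hσ : σ = 0
  · have e : stepsize (1 / 2000) 16 μ L Δ σ R N = 1 / 2000 / m := by
      rw [stepsize, if_pos (Or.inl hσ)]
    rw [e, hR, hσ]
    have := mul_le_mul_of_nonneg_right hA hε.le
    simp only [ne_eq, OfNat.ofNat_ne_zero, not_false_eq_true, zero_pow, mul_zero, zero_div,
      add_zero]
    linarith
  · have e : stepsize (1 / 2000) 16 μ L Δ σ R N = min (1 / 2000 / m)
        (16 / (N * μ) * Real.log (max 2 (μ ^ 2 * N * R ^ 2 / σ ^ 2))) := by
      rw [stepsize, if_neg (by tauto)]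
    have hs1 : 0 < s := by rw [hs, noiseLevel]; positivity
    -- In terms of `u`, the argument `μ² N R² / σ²` of the logarithm is `u * ρ`.
    set u := N / s with hu
    have hNs : (N : ℝ) = u * s := by rw [hu]; field_simp
    have huΛ : 10 ^ 14 * Λ ≤ u := by
      rw [hu, le_div_iff₀ hs1]
      linarith
    have huρ : μ ^ 2 * N * R ^ 2 / σ ^ 2 = u * ρ := by
      rw [hu, hs, noiseLevel, hρd]; field_simp
    rw [huρ] at e
    set g := Real.log (max 2 (u * ρ)) with hg
    have hu0 : 0 < u := by positivity
    -- The constant `145408 = 2·16·4544` makes the noise term `ε / 2`. The lower bound on `N` makes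
    -- `u` large enough to dominate both `log (2 + u)` and `log (2 + ρ)`.
    have hgu : g ≤ u / 145408 := by
      have h1 : g ≤ Real.log ((2 + u) * (2 + ρ)) := by
        refine Real.log_le_log (lt_max_of_lt_left two_pos) (max_le ?_ ?_) <;> nlinarith
      rw [Real.log_mul (by positivity) (by positivity)] at h1
      have h2 := log_two_add_le (u := u) (by linarith)
      linarith
    -- The value `c₂ = 16` matches the contraction rate `γ μ / 16`, so the exponent is exactly `-g`.
    have hB : Real.exp (-(16 / (N * μ) * g * μ / 16 * N)) * ρ ≤ 1 / 2 := by
      have e' : 16 / (N * μ) * g * μ / 16 * N = g := by field_simp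
      rw [e']
      exact exp_neg_log_max_mul_le (by linarith) hρ
    have hfirst : Real.exp (-(stepsize (1 / 2000) 16 μ L Δ σ R N * μ / 16 * N)) * ρ ≤ 1 / 2 := by
      rw [e]
      rcases min_choice (1 / 2000 / m) (16 / (N * μ) * g) with h | h <;> rw [h] <;> assumption
    have hsecond : 4544 * stepsize (1 / 2000) 16 μ L Δ σ R N * σ ^ 2 / μ ≤ 1 / 2 * ε := by
      have h1 : stepsize (1 / 2000) 16 μ L Δ σ R N ≤ 16 / (N * μ) * (u / 145408) := by
        rw [e]
        refine (min_le_right _ _).trans ?_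
        gcongr
      have h2 : 4544 * (16 / (N * μ) * (u / 145408)) * σ ^ 2 / μ = 1 / 2 * ε := by
        rw [hNs]
        have hsε : s * (μ ^ 2 * ε) = σ ^ 2 := by rw [hs, noiseLevel]; field_simp
        rw [← hsε]
        field_simp
        norm_num
      rw [← h2]
      gcongr
    rw [hR]
    have := mul_le_mul_of_nonneg_right hfirst hε.le
    linarith

lemma exists_level_bound {M : ℝ} (hM : 1 ≤ M) :
    ∃ l : ℕ, (∀ i : ℕ, (2 : ℝ) ^ i ≤ M ↔ i ≤ l) ∧ (l : ℝ) ≤ Real.logb 2 M := by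
  have hl : ∀ i : ℕ, (2 : ℝ) ^ i ≤ M ↔ i ≤ Nat.log 2 ⌊M⌋₊ := fun i => by
    have hf : ⌊M⌋₊ ≠ 0 := (Nat.floor_pos.2 hM).ne'
    rw [Nat.le_log_iff_pow_le one_lt_two hf, Nat.le_floor_iff (by linarith)]
    push_cast
    rfl
  refine ⟨_, hl, ?_⟩
  rw [Real.le_logb_iff_rpow_le one_lt_two (by linarith), Real.rpow_natCast]
  exact (hl _).2 le_rfl

/-- As `2·10^7 ≤ 3^16 ≤ A^16`, the constant costs only a power: `M ≤ A^17`. The factor `34 = 2·17`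
comes from `log 2 ≥ 1/2`. -/
lemma logb_batchLimit_le {γ A : ℝ} (hA : 3 ≤ A) (h : 1 / (γ * μ) ≤ 4 * 10 ^ 14 * A ^ 2) :
    Real.logb 2 (batchLimit 1 γ μ) ≤ 34 * Real.log A := by
  have hA0 : 0 < A := by linarith
  have hM : batchLimit 1 γ μ ≤ A ^ 17 := by
    have h3 : (3 : ℝ) ^ 16 ≤ A ^ 16 := pow_le_pow_left₀ (by norm_num) hA 16
    have h4 : (3 : ℝ) ^ 16 * A ≤ A ^ 17 := by
      rw [pow_succ A 16]; exact mul_le_mul_of_nonneg_right h3 hA0.le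
    have h5 : Real.sqrt (1 / (γ * μ)) ≤ 2 * 10 ^ 7 * A := by
      rw [Real.sqrt_le_left (by positivity)]
      refine h.trans (le_of_eq ?_)
      ring
    refine max_le ?_ (h5.trans ?_) <;> nlinarith
  have h0 : 0 < batchLimit 1 γ μ := lt_max_of_lt_left two_pos
  have h1 : Real.log (batchLimit 1 γ μ) ≤ 17 * Real.log A := by
    have := Real.log_le_log h0 hM
    rwa [Real.log_pow] at this
  have h2 := half_le_log_two
  have h3 : 0 ≤ Real.log A := Real.log_nonneg (by linarith)
  rw [Real.logb, div_le_iff₀ (by linarith)]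
  nlinarith

end Parameters

/-- The number of iterations. -/
noncomputable def iterationCount (μ L Δ σ R ε : ℝ) : ℕ :=
  ⌈10 ^ 14 * (condNumber μ L Δ * Real.log (2 + R ^ 2 / ε) + noiseLevel μ σ ε *
    Real.log (2 + condNumber μ L Δ + noiseLevel μ σ ε + R ^ 2 / ε))⌉₊

/-- The cost bound for `N` iterations with `(l + 2) B` expected oracle calls each. -/
lemma iterationCount_mul_le {μ L Δ σ R ε γ M : ℝ} {τ l : ℕ} (hμ : 0 < μ) (hL : 0 < L)
    (hΔ : 0 ≤ Δ) (hε : 0 < ε) (hτ : 1 ≤ τ)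
    (hγ : γ = stepsize (1 / 2000) 16 μ L Δ σ R (iterationCount μ L Δ σ R ε))
    (hM : M = batchLimit 1 γ μ) (hl : (l : ℝ) ≤ Real.logb 2 M) :
    (iterationCount μ L Δ σ R ε : ℝ) * ((l + 2) * baseBatch τ M) ≤
      12 * 1156 * (2 * 10 ^ 14) *
        (τ * (condNumber μ L Δ * Real.log (2 + R ^ 2 / ε) + noiseLevel μ σ ε)) *
        Real.log (2 + condNumber μ L Δ + noiseLevel μ σ ε + R ^ 2 / ε) ^ 3 := by
  have hκ := one_le_condNumber hμ hL hΔ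
  have hinv := inv_stepsize_mul_le (σ := σ) (R := R) (N := iterationCount μ L Δ σ R ε) hμ hL hΔ
  rw [← hγ] at hinv
  set N := iterationCount μ L Δ σ R ε with hN
  rw [iterationCount] at hN
  set κ := condNumber μ L Δ
  set s := noiseLevel μ σ ε with hs
  set ρ := R ^ 2 / ε with hρd
  have hρ : 0 ≤ ρ := by positivity
  have hs0 : 0 ≤ s := by rw [hs, noiseLevel]; positivity
  set A := 2 + κ + s + ρ with hA
  have hA3 : 3 ≤ A := by linarith
  set Λ := Real.log A with hΛ
  set ℓ := Real.log (2 + ρ) with hℓ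
  have hℓ0 : 1 / 2 ≤ ℓ := half_le_log_two.trans (Real.log_le_log two_pos (by linarith))
  have hℓΛ : ℓ ≤ Λ := Real.log_le_log (by linarith) (by linarith)
  have hΛ1 : 1 ≤ Λ := by
    rw [hΛ, Real.le_log_iff_exp_le (by linarith)]
    linarith [Real.exp_one_lt_d9]
  have hΛA : Λ ≤ A := Real.log_le_self (by linarith)
  have hκℓ : 1 / 2 ≤ κ * ℓ := by nlinarith
  have hsΛ : 0 ≤ s * Λ := by positivity
  have hN1 : (N : ℝ) ≤ 10 ^ 14 * (κ * ℓ + s * Λ) + 1 := by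
    rw [hN]; exact (Nat.ceil_lt_add_one (by positivity)).le
  have hN2 : (N : ℝ) ≤ 2 * 10 ^ 14 * ((κ * ℓ + s) * Λ) := by nlinarith
  have hN3 : (N : ℝ) ≤ 2 * 10 ^ 14 * A ^ 2 + 1 := by
    have h1 : κ * ℓ ≤ A * A := mul_le_mul (by linarith) (by linarith) (by linarith) (by linarith)
    have h2 : s * Λ ≤ A * A := mul_le_mul (by linarith) (by linarith) (by linarith) (by linarith)
    nlinarith
  have hlog : Real.logb 2 M ≤ 34 * Λ := by
    rw [hM]
    refine logb_batchLimit_le hA3 (hinv.trans ?_)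
    nlinarith
  have hM2 : 2 ≤ M := hM ▸ le_max_left _ _
  set b := Real.logb 2 M with hb
  have hb1 : 1 ≤ b := by
    rw [hb, Real.le_logb_iff_rpow_le one_lt_two (by linarith), Real.rpow_one]
    exact hM2
  have hτr : (1 : ℝ) ≤ τ := by exact_mod_cast hτ
  have hB : (baseBatch τ M : ℝ) ≤ 2 * τ * b := by
    have h1 : (baseBatch τ M : ℝ) ≤ τ * b + 1 :=
      (Nat.ceil_lt_add_one (by positivity)).le
    nlinarith [mul_le_mul hτr hb1 zero_le_one (by linarith)]
  -- One logarithm comes from `N`, one from `l + 2 ≤ 3 b`, one from `B ≤ 2 τ b`, with `b ≤ 34 Λ` and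
  -- `1156 = 34²`.
  calc (N : ℝ) * ((l + 2) * baseBatch τ M)
      ≤ (2 * 10 ^ 14 * ((κ * ℓ + s) * Λ)) * ((3 * b) * (2 * τ * b)) := by
        gcongr
        linarith
    _ = 12 * 10 ^ 14 * τ * ((κ * ℓ + s) * Λ) * b ^ 2 := by ring
    _ ≤ 12 * 10 ^ 14 * τ * ((κ * ℓ + s) * Λ) * (34 * Λ) ^ 2 := by gcongr
    _ ≤ 12 * 1156 * (2 * 10 ^ 14) * (τ * (κ * ℓ + s)) * Λ ^ 3 := by
        have : 0 ≤ (τ * (κ * ℓ + s)) * Λ ^ 3 := by positivity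
        nlinarith

/-! ### Choice of the parameters and conclusion. -/

theorem mainTheorem9 :
    ∃ c₁ c₂ c₃ C : ℝ, 0 < c₁ ∧ 0 < c₂ ∧ 0 < c₃ ∧ 0 < C ∧
      ∀ (μF μr μ L Δ σ R ε : ℝ) (τ : ℕ),
        0 ≤ μF → 0 ≤ μr → μ = μF + μr → 0 < μ → 0 < L → 0 ≤ Δ → 0 ≤ σ → 0 < ε →
        -- the parameters of the method depend only on the constants of the problem
        ∃ (N : ℕ) (γ M : ℝ) (B : ℕ),
          γ = stepsize c₁ c₂ μ L Δ σ R N ∧ M = batchLimit c₃ γ μ ∧ B = baseBatch τ M ∧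
          ∀ (d : ℕ) (X : Set (RSpace d)) (F : RSpace d → RSpace d) (r : RSpace d → ℝ)
            (xs x₀ : RSpace d),
            IsMonotoneVI X F r L μF μr → IsVISolution X F r xs → x₀ ∈ X → ‖x₀ - xs‖ = R →
          ∀ {S : Type*} [MeasurableSpace S] (Q : Kernel S S) [IsMarkovKernel Q]
            (π : Measure S) [IsProbabilityMeasure π] (Fz : RSpace d → S → RSpace d),
            IsUniformlyErgodic Q τ → Q.Invariant π → IsNoisyOracle X F Fz π xs σ Δ →
          ∀ {Ω : Type*} [MeasurableSpace Ω] (P : Measure Ω) [IsProbabilityMeasure P]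
            (Z : ℕ → Ω → S) (J : ℕ → Ω → ℕ) (xN : Ω → RSpace d) (calls : Ω → ℝ),
            IsMarkovChain P π Q Z → IsGeometricSequence P J →
            IndepFun (fun ω n => Z n ω) (fun ω k => J k ω) P →
            (∀ ω, xN ω =
              (extragradState X r Fz γ M B x₀ (fun n => Z n ω) (fun k => J k ω) N).1) →
            (∀ ω, calls ω = oracleCalls M B (fun k => J k ω) N) →
          (Integrable (fun ω => ‖xN ω - xs‖ ^ 2) P ∧ ∫ ω, ‖xN ω - xs‖ ^ 2 ∂P ≤ ε) ∧
          (Integrable calls P ∧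
            ∫ ω, calls ω ∂P ≤
              C * (τ * (condNumber μ L Δ * Real.log (2 + R ^ 2 / ε) + noiseLevel μ σ ε)) *
                Real.log (2 + condNumber μ L Δ + noiseLevel μ σ ε + R ^ 2 / ε) ^ 3) := by
  refine ⟨1 / 2000, 16, 1, 12 * 1156 * (2 * 10 ^ 14), by norm_num, by norm_num, by norm_num,
    by norm_num, ?_⟩
  intro μF μr μ L Δ σ R ε τ hμF hμr hμe hμ hL hΔ _ hε
  obtain ⟨γ, hγd⟩ : ∃ γ, γ = stepsize (1 / 2000) 16 μ L Δ σ R (iterationCount μ L Δ σ R ε) :=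
    ⟨_, rfl⟩
  obtain ⟨M, hMd⟩ : ∃ M, M = batchLimit 1 γ μ := ⟨_, rfl⟩
  obtain ⟨B, hBd⟩ : ∃ B, B = baseBatch τ M := ⟨_, rfl⟩
  refine ⟨iterationCount μ L Δ σ R ε, γ, M, B, hγd, hMd, hBd, ?_⟩
  intro d X F r xs x₀ hVI hs hx₀ hR S _ Q _ π _ Fz hQ hπ hO Ω _ P _ Z J xN calls hZ hJ hZJ hxN
    hcalls
  obtain rfl : xN = _ := funext hxN
  obtain rfl : calls = _ := funext hcalls
  have hγ : 0 < γ := hγd ▸ stepsize_pos (by norm_num) (by norm_num) hμ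
  have hM2 : 2 ≤ M := hMd ▸ le_max_left _ _
  obtain ⟨l, hl, hlM⟩ := exists_level_bound (by linarith : 1 ≤ M)
  have hb1 : 1 ≤ Real.logb 2 M := by
    rw [Real.le_logb_iff_rpow_le one_lt_two (by linarith), Real.rpow_one]
    exact hM2
  have hτ0 : (0 : ℝ) ≤ τ := by positivity
  have hBge : (τ : ℝ) * Real.logb 2 M ≤ B := hBd ▸ Nat.le_ceil _
  have hτB : τ ≤ B := by
    have : (τ : ℝ) ≤ B := by nlinarith
    exact_mod_cast this
  have hlB : l * τ ≤ B := by
    have : (l : ℝ) * τ ≤ B := by nlinarith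
    exact_mod_cast this
  have hm0 : 0 < max (max μ L) (max (Δ ^ 2 / μ) Δ) := lt_max_of_lt_left (lt_max_of_lt_left hμ)
  have hγm : γ * max (max μ L) (max (Δ ^ 2 / μ) Δ) ≤ 1 / 2000 := by
    rw [← le_div_iff₀ hm0, hγd]
    exact stepsize_le
  have hγle : ∀ a, a ≤ max (max μ L) (max (Δ ^ 2 / μ) Δ) → γ * a ≤ 1 / 2000 := fun a ha =>
    (mul_le_mul_of_nonneg_left ha hγ.le).trans hγm
  have hγμ := hγle μ ((le_max_left _ _).trans (le_max_left _ _))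
  have hγL := hγle L ((le_max_right _ _).trans (le_max_left _ _))
  have hγΔ : γ * Δ ^ 2 ≤ μ / 2000 := by
    have h := hγle (Δ ^ 2 / μ) ((le_max_left _ _).trans (le_max_right _ _))
    rw [← mul_div_assoc, div_le_iff₀ hμ] at h
    linarith
  have hMγ : 1 ≤ γ * μ * M ^ 2 := by
    have h1 : Real.sqrt (1 / (γ * μ)) ≤ M := hMd ▸ le_max_right _ _
    have h2 : 1 / (γ * μ) ≤ M ^ 2 := (Real.sqrt_le_left (by linarith)).1 h1
    rw [div_le_iff₀ (by positivity)] at h2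
    linarith
  obtain ⟨hint, hle⟩ := integral_norm_extragradState_sub_sq_le hVI hs hx₀ hO hQ hπ hγ hμF hμr
    (hμe ▸ hμ) hL.le (lt_of_lt_of_le hQ.1 hτB) (hμe ▸ hγμ) hγL (hμe ▸ hγΔ) (by linarith)
    (hμe ▸ hMγ) hl hτB hlB hZ hJ hZJ (iterationCount μ L Δ σ R ε)
  obtain ⟨hcint, hcle⟩ := integral_oracleCalls_le hJ hl B (iterationCount μ L Δ σ R ε)
  refine ⟨⟨hint, hle.trans ?_⟩, hcint, hcle.trans ?_⟩
  · rw [← hμe, hR]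
    have hN := Nat.le_ceil (10 ^ 14 * (condNumber μ L Δ * Real.log (2 + R ^ 2 / ε) +
      noiseLevel μ σ ε * Real.log (2 + condNumber μ L Δ + noiseLevel μ σ ε + R ^ 2 / ε)))
    have hN0 : iterationCount μ L Δ σ R ε ≠ 0 := by
      have h1 : 0 < condNumber μ L Δ * Real.log (2 + R ^ 2 / ε) :=
        mul_pos (by linarith [one_le_condNumber hμ hL hΔ])
          (Real.log_pos (by linarith [div_nonneg (sq_nonneg R) hε.le]))
      have hs0 : 0 ≤ noiseLevel μ σ ε := by rw [noiseLevel]; positivity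
      have h2 : 0 ≤ Real.log (2 + condNumber μ L Δ + noiseLevel μ σ ε + R ^ 2 / ε) :=
        Real.log_nonneg (by
          linarith [one_le_condNumber hμ hL hΔ, div_nonneg (sq_nonneg R) hε.le])
      exact (Nat.ceil_pos.2 (by positivity)).ne'
    refine le_trans ?_ (accuracy_le (σ := σ) (R := R) hμ hL hΔ hε hN0 hN)
    rw [← hγd]
    have hpow : (1 - γ * μ / 16) ^ iterationCount μ L Δ σ R ε ≤
        Real.exp (-(γ * μ / 16 * iterationCount μ L Δ σ R ε)) := by
      have h1 : 1 - γ * μ / 16 ≤ Real.exp (-(γ * μ / 16)) := by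
        linarith [Real.add_one_le_exp (-(γ * μ / 16))]
      refine (pow_le_pow_left₀ (by linarith) h1 _).trans (le_of_eq ?_)
      rw [← Real.exp_nat_mul]
      congr 1
      ring
    gcongr
  · rw [hBd]
    exact iterationCount_mul_le hμ hL hΔ hε hQ.1 hγd hMd hlM
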